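/- Let $d\ge 3$ and let $X_n$, $n=0,1,\dots$, be a random walk on $\mathbb Z^d$ with $X_0=0$ (i.i.d. increments). For $A\subseteq\mathbb Z^d$ put $\mu^X_n(A)=\sum_{j=0}^n \mathbf 1_A(X_j)$. Let $\gamma_d=\mathbf P(X_s\neq 0\text{ for all } s\ge 1)$ be the probability of no return to the origin and, for $y\in\mathbb Z^d$, let $t_y=\mathbf P(X_s=y\text{ for some } s\ge 1)$. Let $e_1,\dots,e_d$ be the standard unit vectors, $S(0,1)=\{\pm e_1,\dots,\pm e_d\}$ and $B(0,1)=\{0\}\cup S(0,1)$. (a) Suppose that the walk is symmetric ($X_1$ and $-X_1$ have the same law), transient, not supported on any proper subgroup of $\mathbb Z^d$, and has finite second moments. Then for every $0\neq y\in\mathbb Z^d$, almost surely, $$\lim_{n\to\infty}\sup_{x\in\mathbb Z^d}\frac{\mu^X_n(x+\{0,y\})}{\log n}=\frac{-1}{\log\left(1-\frac{\gamma_d}{1+t_y}\right)}.$$ (b) Suppose that $X$ is the simple random walk, i.e. $\mathbf P(X_1=\pm e_i)=\frac1{2d}$ for each $i$ and each sign. Then, almost surely, $$\lim_{n\to\infty}\sup_{x\in\mathbb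 Z^d}\frac{\mu^X_n(x+S(0,1))}{\log n}=\frac{-1}{\log\left(1-\frac{\gamma_d}{2d(1-\gamma_d)}\right)}$$ and, almost surely, $$\lim_{n\to\infty}\sup_{x\in\mathbb Z^d}\frac{\mu^X_n(x+B(0,1))}{\log n}=\frac{-1}{\log\left(\frac{p+\sqrt{p^2+2/d}}{2}\right)},\qquad p=1-\frac{1}{2d(1-\gamma_d)}.$$ -/

import Mathlib

open MeasureTheory ProbabilityTheory Filter Topology

namespace LatticeWalk

variable {d : ℕ} {Ω : Type*} [MeasurableSpace Ω]

/-- `X` is a random walk on `ℤ^d` started at the origin: its increments are independent and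
identically distributed. -/
structure IsRandomWalk (X : ℕ → Ω → (Fin d → ℤ)) (P : Measure Ω) : Prop where
  measurable : ∀ n, Measurable (X n)
  start : ∀ᵐ ω ∂P, X 0 ω = 0
  indep : iIndepFun (fun n ω => X (n + 1) ω - X n ω) P
  ident : ∀ n, IdentDistrib (fun ω => X (n + 1) ω - X n ω) (X 1) P P

/-- The step distribution is symmetric. -/
def IsSymmetric (X : ℕ → Ω → (Fin d → ℤ)) (P : Measure Ω) : Prop :=
  IdentDistrib (X 1) (fun ω => -X 1 ω) P P

/-- The walk is not supported on any proper subgroup of `ℤ^d`. -/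
def IsFull (X : ℕ → Ω → (Fin d → ℤ)) (P : Measure Ω) : Prop :=
  ∀ H : AddSubgroup (Fin d → ℤ), (∀ n, ∀ᵐ ω ∂P, X n ω ∈ H) → H = ⊤

/-- The steps have finite second moments. -/
def HasSecondMoments (X : ℕ → Ω → (Fin d → ℤ)) (P : Measure Ω) : Prop :=
  ∀ i, MemLp (fun ω => (X 1 ω i : ℝ)) 2 P

/-- `t_y`, the probability that the walk is at `y` at some time `s > 0`. -/
noncomputable def hitProb (X : ℕ → Ω → (Fin d → ℤ)) (P : Measure Ω) (y : Fin d → ℤ) : ℝ :=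
  P.real {ω | ∃ s, 0 < s ∧ X s ω = y}

/-- `γ_d`, the probability that the walk never returns to the origin. -/
noncomputable def noReturnProb (X : ℕ → Ω → (Fin d → ℤ)) (P : Measure Ω) : ℝ :=
  P.real {ω | ∀ s, 0 < s → X s ω ≠ 0}

/-- The walk is transient: with positive probability it never returns to the origin. -/
def IsTransient (X : ℕ → Ω → (Fin d → ℤ)) (P : Measure Ω) : Prop :=
  0 < noReturnProb X P

/-- The Euclidean unit sphere `S(0,1) = {e_1, …, e_d, -e_1, …, -e_d}` in `ℤ^d`. -/
def unitSphere (d : ℕ) : Set (Fin d → ℤ) :=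
  {x | ∃ i, x = Pi.single i 1 ∨ x = -Pi.single i 1}

/-- The Euclidean unit ball `B(0,1) = {0} ∪ S(0,1)` in `ℤ^d`. -/
def unitBall (d : ℕ) : Set (Fin d → ℤ) :=
  insert 0 (unitSphere d)

/-- The steps are those of the simple random walk: uniform on the `2d` unit vectors. -/
def IsSimple (X : ℕ → Ω → (Fin d → ℤ)) (P : Measure Ω) : Prop :=
  ∀ x ∈ unitSphere d, P.real {ω | X 1 ω = x} = 1 / (2 * (d : ℝ))

/-- The occupation measure `μ_n(A) = ∑_{j=0}^n 1_A(X_j)` of a path `x`. -/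
noncomputable def occupation (x : ℕ → (Fin d → ℤ)) (n : ℕ) (A : Set (Fin d → ℤ)) : ℝ :=
  ∑ j ∈ Finset.range (n + 1), A.indicator 1 (x j)

/-- `sup_{z ∈ ℤ^d} μ_n(z + A) / log n`. For `n ≥ 2` the family is bounded by `(n + 1) / log n`. -/
noncomputable def maxOccupationRatio (x : ℕ → (Fin d → ℤ)) (A : Set (Fin d → ℤ)) (n : ℕ) : ℝ :=
  ⨆ z : Fin d → ℤ, occupation x n ((fun a => z + a) '' A) / Real.log n

end LatticeWalk

open LatticeWalk

/-!
Let `h x` be the probability that the walk from `x` ever visits `0`. If `w > 0` on the finite set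
`A` satisfies `∑ a ∈ A, w a * h (x - a) = Λ * w x` for `x ∈ A`, then the potential
`φ x = ∑ a ∈ A, w a * h (x - a)` is harmonic off `A`, while on `A` one step of the walk multiplies
it in mean by `1 - γ / Λ`, because `φ` fails to be harmonic there only by `γ * w x = (γ / Λ) * φ x`.
Hence each further visit to `A` costs a factor `1 - γ / Λ` in probability, up to bounded factors.
A union bound over the starting times of the visits bounds the largest occupation of a translate of
`A` from above, and splitting the time interval into independent blocks bounds it from below; with
Borel–Cantelli along the powers of two both give the limit `-1 / log (1 - γ / Λ)`. The constants of
the theorem are the values of `Λ` for `{0, y}`, for the sphere, and for the ball.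
-/

namespace LatticeWalk

open scoped ENNReal

section Balayage

variable {E : Type*} [Add E] [MeasurableSpace E] {ν : Measure E}

/-- The transition operator of the walk with step law `ν`, acting on `[0, ∞]`-valued functions so
that no integrability conditions arise. -/
noncomputable def transition (ν : Measure E) (f : E → ℝ≥0∞) (x : E) : ℝ≥0∞ :=
  ∫⁻ z, f (x + z) ∂ν

open Classical in
/-- `visitExpect ν A f n k x` is `E_x[f(X_τ); τ ≤ n]` for the walk from `x` with step law `ν`, where
`τ` is the time of the visit number `k` to `A`, the visit at time `0` (if any) being number `0`.
It is defined by conditioning on the first step. -/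
noncomputable def visitExpect (ν : Measure E) (A : Set E) (f : E → ℝ≥0∞) : ℕ → ℕ → E → ℝ≥0∞
  | 0, 0 => A.indicator f
  | 0, _ + 1 => 0
  | n + 1, 0 => A.piecewise f (transition ν (visitExpect ν A f n 0))
  | n + 1, k + 1 =>
    A.piecewise (transition ν (visitExpect ν A f n k)) (transition ν (visitExpect ν A f n (k + 1)))

/-- The balayage of `f` on `A`: the function `x ↦ E_x[f(X_τ); τ < ∞]`, where `τ ≥ 0` is the time of
the first visit to `A`. -/
noncomputable def balayage (ν : Measure E) (A : Set E) (f : E → ℝ≥0∞) (x : E) : ℝ≥0∞ :=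
  ⨆ n, visitExpect ν A f n 0 x

theorem transition_mono {f g : E → ℝ≥0∞} (h : f ≤ g) : transition ν f ≤ transition ν g :=
  fun _ ↦ lintegral_mono fun _ ↦ h _

theorem transition_const [IsProbabilityMeasure ν] (c : ℝ≥0∞) (x : E) :
    transition ν (fun _ ↦ c) x = c := by
  simp [transition]

variable {A B : Set E} {f g : E → ℝ≥0∞} {x : E}

theorem visitExpect_zero_right_of_mem (hx : x ∈ A) (n : ℕ) : visitExpect ν A f n 0 x = f x := by
  cases n <;> simp [visitExpect, hx]

theorem visitExpect_succ_succ_of_mem (hx : x ∈ A) (n k : ℕ) :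
    visitExpect ν A f (n + 1) (k + 1) x = transition ν (visitExpect ν A f n k) x := by
  simp [visitExpect, hx]

theorem visitExpect_zero_left_of_notMem (hx : x ∉ A) (k : ℕ) : visitExpect ν A f 0 k x = 0 := by
  cases k <;> simp [visitExpect, hx]

theorem visitExpect_zero_succ (k : ℕ) : visitExpect ν A f 0 (k + 1) = 0 := by
  simp only [visitExpect]

theorem visitExpect_succ_left_of_notMem (hx : x ∉ A) (n k : ℕ) :
    visitExpect ν A f (n + 1) k x = transition ν (visitExpect ν A f n k) x := by
  cases k <;> simp [visitExpect, hx]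

/-- The branches of the recursion defining `visitExpect`: an induction on the time horizon that
treats the starting point uniformly. -/
theorem visitExpect_induction {E : Type*} {A : Set E} {p : ℕ → ℕ → E → Prop}
    (mem_zero : ∀ n, ∀ x ∈ A, p n 0 x)
    (zero_succ : ∀ k, ∀ x ∈ A, p 0 (k + 1) x) (zero_notMem : ∀ k, ∀ x ∉ A, p 0 k x)
    (mem_succ : ∀ n k, (∀ y, p n k y) → ∀ x ∈ A, p (n + 1) (k + 1) x)
    (notMem_succ : ∀ n k, (∀ y, p n k y) → ∀ x ∉ A, p (n + 1) k x) (n k : ℕ) (x : E) :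
    p n k x := by
  induction n generalizing k x with
  | zero =>
    by_cases hx : x ∈ A
    · cases k with
      | zero => exact mem_zero 0 x hx
      | succ k => exact zero_succ k x hx
    · exact zero_notMem k x hx
  | succ n ih =>
    by_cases hx : x ∈ A
    · cases k with
      | zero => exact mem_zero _ x hx
      | succ k => exact mem_succ n k (ih k) x hx
    · exact notMem_succ n k (ih k) x hx

theorem visitExpect_mono_time (k : ℕ) : Monotone fun n ↦ visitExpect ν A f n k := by
  refine monotone_nat_of_le_succ fun n ↦ Pi.le_def.2 fun x ↦ ?_
  induction n, k, x using visitExpect_induction (A := A) with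
  | mem_zero n x hx => simp only [visitExpect_zero_right_of_mem hx, le_refl]
  | zero_succ k x _ => simp [visitExpect_zero_succ]
  | zero_notMem k x hx => simp [visitExpect_zero_left_of_notMem hx]
  | mem_succ n k ih x hx =>
    simpa only [visitExpect_succ_succ_of_mem hx] using transition_mono ih x
  | notMem_succ n k ih x hx =>
    simpa only [visitExpect_succ_left_of_notMem hx] using transition_mono ih x

theorem visitExpect_mono (h : ∀ x ∈ A, f x ≤ g x) (n k : ℕ) :
    visitExpect ν A f n k ≤ visitExpect ν A g n k := by
  refine Pi.le_def.2 fun x ↦ ?_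
  induction n, k, x using visitExpect_induction (A := A) with
  | mem_zero n x hx => simpa only [visitExpect_zero_right_of_mem hx] using h x hx
  | zero_succ k x _ => simp [visitExpect_zero_succ]
  | zero_notMem k x hx => simp [visitExpect_zero_left_of_notMem hx]
  | mem_succ n k ih x hx =>
    simpa only [visitExpect_succ_succ_of_mem hx] using transition_mono ih x
  | notMem_succ n k ih x hx =>
    simpa only [visitExpect_succ_left_of_notMem hx] using transition_mono ih x

theorem visitExpect_comp {τ : E → E}
    (hτ : ∀ (g : E → ℝ≥0∞) (x : E), transition ν g (τ x) = transition ν (g ∘ τ) x)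
    (n k : ℕ) (x : E) :
    visitExpect ν A f n k (τ x) = visitExpect ν (τ ⁻¹' A) (f ∘ τ) n k x := by
  induction n, k, x using visitExpect_induction (A := τ ⁻¹' A) with
  | mem_zero n x hx =>
    rw [visitExpect_zero_right_of_mem hx, visitExpect_zero_right_of_mem (A := A) hx,
      Function.comp_apply]
  | zero_succ k x _ => simp [visitExpect_zero_succ]
  | zero_notMem k x hx =>
    rw [visitExpect_zero_left_of_notMem hx, visitExpect_zero_left_of_notMem (A := A) hx]
  | mem_succ n k ih x hx =>
    rw [visitExpect_succ_succ_of_mem hx, visitExpect_succ_succ_of_mem (A := A) hx, hτ,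
      ← funext ih, Function.comp_def]
  | notMem_succ n k ih x hx =>
    rw [visitExpect_succ_left_of_notMem hx, visitExpect_succ_left_of_notMem (A := A) hx, hτ,
      ← funext ih, Function.comp_def]

theorem balayage_comp {τ : E → E}
    (hτ : ∀ (g : E → ℝ≥0∞) (x : E), transition ν g (τ x) = transition ν (g ∘ τ) x) (x : E) :
    balayage ν A f (τ x) = balayage ν (τ ⁻¹' A) (f ∘ τ) x :=
  iSup_congr fun n ↦ visitExpect_comp hτ n 0 x

theorem balayage_of_mem (hx : x ∈ A) : balayage ν A f x = f x := by
  simp [balayage, visitExpect_zero_right_of_mem hx]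

theorem balayage_congr (h : Set.EqOn f g A) : balayage ν A f = balayage ν A g :=
  funext fun x ↦ iSup_congr fun n ↦
    le_antisymm (visitExpect_mono (fun _ hy ↦ (h hy).le) n 0 x)
      (visitExpect_mono (fun _ hy ↦ (h hy).ge) n 0 x)

variable [DiscreteMeasurableSpace E]

theorem transition_const_mul (c : ℝ≥0∞) (f : E → ℝ≥0∞) (x : E) :
    transition ν (fun y ↦ c * f y) x = c * transition ν f x :=
  lintegral_const_mul c .of_discrete

theorem transition_sum {ι : Type*} (s : Finset ι) (f : ι → E → ℝ≥0∞) (x : E) :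
    transition ν (fun y ↦ ∑ i ∈ s, f i y) x = ∑ i ∈ s, transition ν (f i) x :=
  lintegral_finsetSum s fun _ _ ↦ .of_discrete

theorem transition_iSup {f : ℕ → E → ℝ≥0∞} (hf : Monotone f) (x : E) :
    transition ν (fun y ↦ ⨆ n, f n y) x = ⨆ n, transition ν (f n) x :=
  lintegral_iSup (fun _ ↦ .of_discrete) fun _ _ h _ ↦ hf h _

theorem visitExpect_const_mul (c : ℝ≥0∞) (n k : ℕ) (x : E) :
    visitExpect ν A (fun y ↦ c * f y) n k x = c * visitExpect ν A f n k x := by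
  induction n, k, x using visitExpect_induction (A := A) with
  | mem_zero n x hx => simp only [visitExpect_zero_right_of_mem hx]
  | zero_succ k x _ => simp [visitExpect_zero_succ]
  | zero_notMem k x hx => simp [visitExpect_zero_left_of_notMem hx]
  | mem_succ n k ih x hx =>
    rw [visitExpect_succ_succ_of_mem hx, visitExpect_succ_succ_of_mem hx, funext ih,
      transition_const_mul]
  | notMem_succ n k ih x hx =>
    rw [visitExpect_succ_left_of_notMem hx, visitExpect_succ_left_of_notMem hx, funext ih,
      transition_const_mul]

theorem visitExpect_sum {ι : Type*} (s : Finset ι) (f : ι → E → ℝ≥0∞) (n k : ℕ) (x : E) :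
    visitExpect ν A (fun y ↦ ∑ i ∈ s, f i y) n k x = ∑ i ∈ s, visitExpect ν A (f i) n k x := by
  induction n, k, x using visitExpect_induction (A := A) with
  | mem_zero n x hx => simp only [visitExpect_zero_right_of_mem hx]
  | zero_succ k x _ => simp [visitExpect_zero_succ]
  | zero_notMem k x hx => simp [visitExpect_zero_left_of_notMem hx]
  | mem_succ n k ih x hx =>
    simp only [visitExpect_succ_succ_of_mem hx, funext ih, transition_sum]
  | notMem_succ n k ih x hx =>
    simp only [visitExpect_succ_left_of_notMem hx, funext ih, transition_sum]

theorem visitExpect_le_pow_mul {r : ℝ≥0∞} (hoff : ∀ x ∉ A, transition ν f x ≤ f x)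
    (hon : ∀ x ∈ A, transition ν f x ≤ r * f x) (n k : ℕ) (x : E) :
    visitExpect ν A f n k x ≤ r ^ k * f x := by
  induction n, k, x using visitExpect_induction (A := A) with
  | mem_zero n x hx => simp [visitExpect_zero_right_of_mem hx]
  | zero_succ k x _ => simp [visitExpect_zero_succ]
  | zero_notMem k x hx => simp [visitExpect_zero_left_of_notMem hx]
  | mem_succ n k ih x hx =>
    rw [visitExpect_succ_succ_of_mem hx]
    calc transition ν (visitExpect ν A f n k) x
        ≤ r ^ k * transition ν f x := transition_const_mul (r ^ k) f x ▸ transition_mono ih x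
      _ ≤ r ^ k * (r * f x) := by gcongr; exact hon x hx
      _ = r ^ (k + 1) * f x := by ring
  | notMem_succ n k ih x hx =>
    rw [visitExpect_succ_left_of_notMem hx]
    calc transition ν (visitExpect ν A f n k) x
        ≤ r ^ k * transition ν f x := transition_const_mul (r ^ k) f x ▸ transition_mono ih x
      _ ≤ r ^ k * f x := by gcongr; exact hoff x hx

theorem pow_mul_visitExpect_le {r : ℝ≥0∞} {m : ℕ}
    (hon : ∀ x ∈ A, r * f x ≤ transition ν (visitExpect ν A f m 0) x) (k j : ℕ) (x : E) :
    r ^ k * visitExpect ν A f j 0 x ≤ visitExpect ν A f ((m + 1) * k + j) k x := by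
  induction k generalizing j x with
  | zero => simp
  | succ k ihk =>
    have of_mem : ∀ j, ∀ x ∈ A, r ^ (k + 1) * visitExpect ν A f j 0 x ≤
        visitExpect ν A f ((m + 1) * (k + 1) + j) (k + 1) x := by
      intro j x hx
      rw [show (m + 1) * (k + 1) + j = (m + 1) * k + m + j + 1 by ring,
        visitExpect_succ_succ_of_mem hx, visitExpect_zero_right_of_mem hx]
      calc r ^ (k + 1) * f x = r ^ k * (r * f x) := by ring
        _ ≤ r ^ k * transition ν (visitExpect ν A f m 0) x := by gcongr; exact hon x hx
        _ = transition ν (fun y ↦ r ^ k * visitExpect ν A f m 0 y) x :=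
          (transition_const_mul ..).symm
        _ ≤ transition ν (visitExpect ν A f ((m + 1) * k + m + j) k) x :=
          transition_mono (fun y ↦ (ihk m y).trans
            (visitExpect_mono_time k (Nat.le_add_right _ j) y)) x
    induction j generalizing x with
    | zero =>
      by_cases hx : x ∈ A
      · exact of_mem 0 x hx
      · simp [visitExpect_zero_left_of_notMem hx]
    | succ j ihj =>
      by_cases hx : x ∈ A
      · exact of_mem _ x hx
      · rw [← add_assoc, visitExpect_succ_left_of_notMem hx, visitExpect_succ_left_of_notMem hx,
          ← transition_const_mul]
        exact transition_mono ihj x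

theorem visitExpect_one_le_one [IsProbabilityMeasure ν] (n k : ℕ) (x : E) :
    visitExpect ν A 1 n k x ≤ 1 := by
  have h : transition ν (1 : E → ℝ≥0∞) = 1 := funext (transition_const 1)
  simpa using visitExpect_le_pow_mul (ν := ν) (A := A) (f := 1) (r := 1) (by simp [h])
    (by simp [h]) n k x

theorem visitExpect_mono_set (hf : transition ν f ≤ f) (hAB : A ⊆ B) (n : ℕ) :
    visitExpect ν A f n 0 ≤ visitExpect ν B f n 0 := by
  have le_self : ∀ n, visitExpect ν A f n 0 ≤ f := fun n x ↦ by
    simpa using visitExpect_le_pow_mul (r := 1) (fun y _ ↦ hf y) (fun y _ ↦ by simpa using hf y)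
      n 0 x
  refine Pi.le_def.2 fun x ↦ ?_
  induction n generalizing x with
  | zero => exact Set.indicator_le_indicator_of_subset hAB (fun _ ↦ zero_le) x
  | succ n ih =>
    by_cases hx : x ∈ B
    · rw [visitExpect_zero_right_of_mem hx]
      exact le_self _ x
    · rw [visitExpect_succ_left_of_notMem hx,
        visitExpect_succ_left_of_notMem fun h ↦ hx (hAB h)]
      exact transition_mono ih x

theorem transition_balayage (x : E) :
    transition ν (balayage ν A f) x = ⨆ n, transition ν (visitExpect ν A f n 0) x :=
  transition_iSup (visitExpect_mono_time 0) x

theorem transition_balayage_of_notMem (hx : x ∉ A) :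
    transition ν (balayage ν A f) x = balayage ν A f x := by
  have mono : Monotone fun n ↦ visitExpect ν A f n 0 x := fun _ _ h ↦ visitExpect_mono_time 0 h x
  rw [transition_balayage, balayage, ← mono.iSup_nat_add 1]
  simp only [visitExpect_succ_left_of_notMem hx]

theorem balayage_const_mul (c : ℝ≥0∞) (x : E) :
    balayage ν A (fun y ↦ c * f y) x = c * balayage ν A f x := by
  simp only [balayage, visitExpect_const_mul, ENNReal.mul_iSup]

theorem balayage_sum {ι : Type*} (s : Finset ι) (f : ι → E → ℝ≥0∞) (x : E) :
    balayage ν A (fun y ↦ ∑ i ∈ s, f i y) x = ∑ i ∈ s, balayage ν A (f i) x := by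
  simp only [balayage, visitExpect_sum]
  exact (ENNReal.finsetSum_iSup_of_monotone (f := fun i n ↦ visitExpect ν A (f i) n 0 x)
    fun i _ _ h ↦ visitExpect_mono_time 0 h x).symm

theorem balayage_mono_set (hf : transition ν f ≤ f) (hAB : A ⊆ B) :
    balayage ν A f ≤ balayage ν B f :=
  fun x ↦ iSup_mono fun n ↦ visitExpect_mono_set hf hAB n x

theorem balayage_le (hf : transition ν f ≤ f) : balayage ν A f ≤ f := fun x ↦
  (balayage_mono_set hf A.subset_univ x).trans_eq (balayage_of_mem (Set.mem_univ x))

end Balayage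

section Potential

variable {E : Type*} [AddCommGroup E] [MeasurableSpace E] {ν : Measure E}

/-- `hitting ν x` is the probability that the walk from `x` with step law `ν` ever visits `0`, the
starting time included, so that `hitting ν 0 = 1`. -/
noncomputable def hitting (ν : Measure E) : E → ℝ≥0∞ :=
  balayage ν {0} 1

/-- The hitting potential `x ↦ ∑ a ∈ A, w a * hitting ν (x - a)` of the weight `w` on `A`. -/
noncomputable def potential (ν : Measure E) (A : Finset E) (w : E → ℝ≥0∞) (x : E) : ℝ≥0∞ :=
  ∑ a ∈ A, w a * hitting ν (x - a)

theorem hitting_zero : hitting ν (0 : E) = 1 :=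
  balayage_of_mem rfl

theorem transition_sub_right (g : E → ℝ≥0∞) (c x : E) :
    transition ν (fun y ↦ g (y - c)) x = transition ν g (x - c) := by
  simp only [transition, add_sub_right_comm]

theorem balayage_singleton (a : E) : balayage ν {a} 1 = fun x ↦ hitting ν (x - a) := by
  funext x
  rw [hitting, balayage_comp fun g y ↦ (transition_sub_right g a y).symm]
  congr 1
  ext y
  simp [sub_eq_zero]

variable [DiscreteMeasurableSpace E]

theorem hitting_le_one [IsProbabilityMeasure ν] (x : E) : hitting ν x ≤ 1 :=
  iSup_le fun n ↦ visitExpect_one_le_one n 0 x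

theorem hitting_ne_top [IsProbabilityMeasure ν] (x : E) : hitting ν x ≠ ⊤ :=
  ne_top_of_le_ne_top ENNReal.one_ne_top (hitting_le_one x)

theorem transition_hitting {x : E} (hx : x ≠ 0) : transition ν (hitting ν) x = hitting ν x :=
  transition_balayage_of_notMem hx

theorem transition_hitting_le_one [IsProbabilityMeasure ν] (x : E) :
    transition ν (hitting ν) x ≤ 1 :=
  (transition_mono hitting_le_one x).trans_eq (transition_const 1 x)

theorem transition_hitting_le [IsProbabilityMeasure ν] : transition ν (hitting ν) ≤ hitting ν := by
  intro x
  rcases eq_or_ne x 0 with rfl | hx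
  · exact hitting_zero (ν := ν) ▸ transition_hitting_le_one 0
  · exact (transition_hitting hx).le

theorem mul_hitting_le {f : E → ℝ≥0∞} (hf : transition ν f ≤ f) (x : E) :
    f 0 * hitting ν x ≤ f x := by
  calc f 0 * hitting ν x = balayage ν {0} (fun _ ↦ f 0 * 1) x := (balayage_const_mul ..).symm
    _ = balayage ν {0} f x := by rw [balayage_congr]; rintro _ rfl; simp
    _ ≤ f x := balayage_le hf x

theorem mul_le_transition (f : E → ℝ≥0∞) (x z : E) : ν {z} * f (x + z) ≤ transition ν f x := by
  rw [mul_comm, ← lintegral_singleton (fun y ↦ f (x + y))]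
  exact setLIntegral_le_lintegral _ _

theorem measure_singleton_neg_le_hitting {x : E} (hx : x ≠ 0) : ν {-x} ≤ hitting ν x := by
  rw [← transition_hitting hx]
  simpa [hitting_zero] using mul_le_transition (ν := ν) (hitting ν) x (-x)

theorem hitting_map {σ : E ≃+ E} (hσ : ν.map σ = ν) (x : E) : hitting ν (σ x) = hitting ν x := by
  have hτ (g : E → ℝ≥0∞) (x : E) : transition ν g (σ x) = transition ν (g ∘ σ) x := by
    conv_lhs => rw [transition, ← hσ, lintegral_map .of_discrete .of_discrete]
    simp [transition]
  rw [hitting, balayage_comp hτ]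
  congr 1
  ext y
  simp

theorem hitting_neg (hν : ν.map Neg.neg = ν) (x : E) : hitting ν (-x) = hitting ν x :=
  hitting_map (σ := AddEquiv.neg E) hν x

theorem transition_hitting_zero_pos [Countable E] [IsProbabilityMeasure ν]
    (hν : ν.map Neg.neg = ν) : 0 < transition ν (hitting ν) 0 := by
  obtain ⟨z, hz⟩ : ∃ z, ν {z} ≠ 0 := by
    by_contra! h
    exact IsProbabilityMeasure.ne_zero ν (Measure.ext_of_singleton (by simpa using h))
  refine lt_of_lt_of_le ?_ (mul_le_transition (hitting ν) 0 z)
  rw [zero_add]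
  refine ENNReal.mul_pos hz ?_
  rcases eq_or_ne z 0 with rfl | hz0
  · simp [hitting_zero]
  · rw [← hitting_neg hν]
    have := measure_singleton_neg_le_hitting (ν := ν) (neg_ne_zero.2 hz0)
    rw [neg_neg] at this
    exact ((pos_iff_ne_zero.2 hz).trans_le this).ne'

variable {A : Finset E} {w : E → ℝ≥0∞}

theorem transition_potential (x : E) :
    transition ν (potential ν A w) x = ∑ a ∈ A, w a * transition ν (hitting ν) (x - a) := by
  unfold potential
  simp only [transition_sum, transition_const_mul, transition_sub_right]

theorem transition_potential_le [IsProbabilityMeasure ν] :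
    transition ν (potential ν A w) ≤ potential ν A w := fun x ↦ by
  rw [transition_potential]
  exact Finset.sum_le_sum fun a _ ↦ by gcongr; exact transition_hitting_le _

/-- The Poisson equation `φ - Tφ = (1 - u) * w` on `A`, stated without subtraction. -/
theorem transition_potential_add {x : E} (hx : x ∈ A) :
    transition ν (potential ν A w) x + w x =
      potential ν A w x + w x * transition ν (hitting ν) 0 := by
  classical
  rw [transition_potential, potential, ← Finset.add_sum_erase A _ hx,
    ← Finset.add_sum_erase A (fun a ↦ w a * hitting ν (x - a)) hx, sub_self, hitting_zero,
    Finset.sum_congr rfl fun a ha ↦ by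
      rw [transition_hitting (sub_ne_zero.2 (Finset.ne_of_mem_erase ha).symm)]]
  ring

theorem balayage_potential [IsProbabilityMeasure ν] :
    balayage ν A (potential ν A w) = potential ν A w := by
  refine le_antisymm (balayage_le transition_potential_le) fun x ↦ ?_
  have translate_le (a : E) : transition ν (fun y ↦ hitting ν (y - a)) ≤
      fun y ↦ hitting ν (y - a) := fun y ↦ by
    rw [transition_sub_right]
    exact transition_hitting_le _
  have hitting_eq (a : E) : hitting ν (x - a) = balayage ν {a} (fun y ↦ hitting ν (y - a)) x := by
    rw [← congrFun (balayage_singleton a) x, balayage_congr]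
    rintro _ rfl
    simp [hitting_zero]
  calc potential ν A w x
      = ∑ a ∈ A, w a * balayage ν {a} (fun y ↦ hitting ν (y - a)) x := by
        simp only [potential, hitting_eq]
    _ ≤ ∑ a ∈ A, w a * balayage ν A (fun y ↦ hitting ν (y - a)) x := by
        gcongr with a ha
        exact balayage_mono_set (translate_le a) (by simpa using ha) x
    _ = balayage ν A (potential ν A w) x := by
        unfold potential
        simp only [balayage_sum, balayage_const_mul]

theorem potential_le [IsProbabilityMeasure ν] (x : E) : potential ν A w x ≤ ∑ a ∈ A, w a :=
  Finset.sum_le_sum fun _ _ ↦ mul_le_of_le_one_right' (hitting_le_one _)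

end Potential

section Visits

variable {E : Type*} {A : Set E} {x y : ℕ → E} {n m : ℕ}

open Classical in
/-- The number of visits of the path `x` to `A` up to and including time `n`. -/
noncomputable def visits (A : Set E) (x : ℕ → E) (n : ℕ) : ℕ :=
  Nat.count (fun j ↦ x j ∈ A) (n + 1)

theorem visits_mono (A : Set E) (x : ℕ → E) : Monotone (visits A x) :=
  fun _ _ h ↦ by classical exact Nat.count_monotone _ (Nat.succ_le_succ h)

theorem visits_le (A : Set E) (x : ℕ → E) (n : ℕ) : visits A x n ≤ n + 1 := by
  classical exact Nat.count_le _

theorem visits_congr (h : ∀ j ≤ n, x j = y j) : visits A x n = visits A y n := by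
  classical
  refine le_antisymm (Nat.count_mono_left fun j hj ↦ ?_) (Nat.count_mono_left fun j hj ↦ ?_) <;>
    simp [h j (Nat.lt_succ_iff.1 hj)]

theorem visits_shift_le (A : Set E) (x : ℕ → E) (t m : ℕ) :
    visits A (fun i ↦ x (t + i)) m ≤ visits A x (t + m) := by
  simp only [visits, add_assoc, Nat.count_add _ t]
  exact Nat.le_add_left _ _

theorem visits_succ_of_mem (h : x 0 ∈ A) (n : ℕ) :
    visits A x (n + 1) = visits A (fun i ↦ x (i + 1)) n + 1 := by
  simp [visits, Nat.count_succ' _ (n + 1), h]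

theorem visits_succ_of_notMem (h : x 0 ∉ A) (n : ℕ) :
    visits A x (n + 1) = visits A (fun i ↦ x (i + 1)) n := by
  simp [visits, Nat.count_succ' _ (n + 1), h]

theorem visits_pos_iff : 0 < visits A x n ↔ ∃ j ≤ n, x j ∈ A := by
  simp [visits, Nat.pos_iff_ne_zero, Nat.count_ne_iff_exists]

/-- Restart the path at its first visit. -/
theorem exists_lt_visits_shift {k : ℕ} (h : k < visits A x n) :
    ∃ j ≤ n, x j ∈ A ∧ k < visits A (fun i ↦ x (j + i)) n := by
  by_cases h0 : x 0 ∈ A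
  · exact ⟨0, n.zero_le, h0, by simpa using h⟩
  induction n generalizing x with
  | zero =>
    obtain ⟨j, hj, hmem⟩ := visits_pos_iff.1 (Nat.zero_lt_of_lt h)
    exact absurd (Nat.le_zero.1 hj ▸ hmem) h0
  | succ n ih =>
    rw [visits_succ_of_notMem h0] at h
    obtain ⟨j, hj, hmem, hk⟩ : ∃ j ≤ n, x (j + 1) ∈ A ∧ k < visits A (fun i ↦ x (j + i + 1)) n := by
      by_cases h1 : x 1 ∈ A
      · exact ⟨0, n.zero_le, h1, by simpa using h⟩
      · exact ih h h1
    refine ⟨j + 1, Nat.succ_le_succ hj, hmem, ?_⟩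
    simpa only [add_right_comm] using hk.trans_le (visits_mono A _ n.le_succ)

theorem measurable_visits [MeasurableSpace E] (hA : MeasurableSet A) (n : ℕ) :
    Measurable fun x : ℕ → E ↦ visits A x n := by
  classical
  simp only [visits, Nat.count_eq_card_filter_range, Finset.card_filter]
  exact Finset.measurable_fun_sum _ fun j _ ↦
    Measurable.ite (measurable_pi_apply j hA) measurable_const measurable_const

variable [AddCommGroup E]

/-- The largest number of visits up to time `n` to a translate of `A`. -/
noncomputable def maxVisits (A : Set E) (x : ℕ → E) (n : ℕ) : ℕ :=
  ⨆ z, visits A (fun i ↦ x i - z) n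

theorem visits_sub_le_maxVisits (A : Set E) (x : ℕ → E) (n : ℕ) (z : E) :
    visits A (fun i ↦ x i - z) n ≤ maxVisits A x n :=
  le_ciSup (f := fun z ↦ visits A (fun i ↦ x i - z) n)
    ⟨n + 1, Set.forall_mem_range.2 fun _ ↦ visits_le _ _ _⟩ z

theorem exists_visits_sub_eq_maxVisits (A : Set E) (x : ℕ → E) (n : ℕ) :
    ∃ z, visits A (fun i ↦ x i - z) n = maxVisits A x n :=
  Nat.sSup_mem (Set.range_nonempty _) ⟨n + 1, Set.forall_mem_range.2 fun _ ↦ visits_le _ _ _⟩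

theorem maxVisits_mono (A : Set E) (x : ℕ → E) : Monotone (maxVisits A x) := fun n m h ↦ by
  obtain ⟨z, hz⟩ := exists_visits_sub_eq_maxVisits A x n
  exact hz ▸ (visits_mono A _ h).trans (visits_sub_le_maxVisits A x m z)

theorem exists_lt_visits_of_lt_maxVisits {k : ℕ} (h : k < maxVisits A x n) :
    ∃ j ≤ n, ∃ a ∈ A, k < visits A (fun i ↦ a + (x (j + i) - x j)) n := by
  obtain ⟨z, hz⟩ := exists_visits_sub_eq_maxVisits A x n
  obtain ⟨j, hj, hmem, hk⟩ := exists_lt_visits_shift (hz ▸ h)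
  exact ⟨j, hj, x j - z, hmem, by simpa using hk⟩

theorem visits_block_le_maxVisits (a : E) {t : ℕ} (h : t + m ≤ n) :
    visits A (fun i ↦ a + (x (t + i) - x t)) m ≤ maxVisits A x n :=
  calc visits A (fun i ↦ a + (x (t + i) - x t)) m
      = visits A (fun i ↦ x (t + i) - (x t - a)) m := by congr 1; funext i; abel
    _ ≤ visits A (fun i ↦ x i - (x t - a)) (t + m) :=
      visits_shift_le A (fun i ↦ x i - (x t - a)) t m
    _ ≤ maxVisits A x n := (visits_mono A _ h).trans (visits_sub_le_maxVisits A x n _)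

end Visits

section Occupation

variable {d : ℕ} {A : Set (Fin d → ℤ)} {x : ℕ → (Fin d → ℤ)}

theorem occupation_image_add (A : Set (Fin d → ℤ)) (x : ℕ → (Fin d → ℤ)) (n : ℕ)
    (z : Fin d → ℤ) : occupation x n ((z + ·) '' A) = visits A (fun i ↦ x i - z) n := by
  classical
  simp [occupation, visits, Nat.count_eq_card_filter_range, Set.indicator_apply, neg_add_eq_sub]

theorem maxOccupationRatio_eq (A : Set (Fin d → ℤ)) (x : ℕ → (Fin d → ℤ)) (n : ℕ) :
    maxOccupationRatio x A n = maxVisits A x n / Real.log n := by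
  have le (z) : occupation x n ((z + ·) '' A) / Real.log n ≤ maxVisits A x n / Real.log n := by
    rw [occupation_image_add]
    gcongr
    exact visits_sub_le_maxVisits A x n z
  obtain ⟨z, hz⟩ := exists_visits_sub_eq_maxVisits A x n
  refine le_antisymm (ciSup_le le) ?_
  rw [← hz, ← occupation_image_add]
  exact le_ciSup ⟨_, Set.forall_mem_range.2 le⟩ z

end Occupation

section Walk

variable {d : ℕ} {Ω : Type*} [MeasurableSpace Ω] {P : Measure Ω} {X : ℕ → Ω → (Fin d → ℤ)}
  {A : Set (Fin d → ℤ)} {ν : Measure (Fin d → ℤ)}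

theorem IsRandomWalk.shift (hX : IsRandomWalk X P) (m : ℕ) :
    IsRandomWalk (fun i ω ↦ X (m + i) ω - X m ω) P where
  measurable n := (hX.measurable _).sub (hX.measurable _)
  start := by simp
  indep := by
    simpa [Function.comp_def, add_assoc] using
      hX.indep.precomp (g := (m + ·)) (add_right_injective m)
  ident n := by
    simpa [add_assoc] using (hX.ident (m + n)).trans (hX.ident m).symm

theorem IsRandomWalk.map_step (hX : IsRandomWalk X P) (m : ℕ) :
    P.map (fun ω ↦ X (m + 1) ω - X m ω) = P.map (X 1) :=
  (hX.ident m).map_eq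

theorem IsRandomWalk.isProbabilityMeasure_map [IsProbabilityMeasure P] (hX : IsRandomWalk X P) :
    IsProbabilityMeasure (P.map (X 1)) :=
  Measure.isProbabilityMeasure_map (hX.measurable 1).aemeasurable

theorem IsRandomWalk.measure_congr_of_start (hX : IsRandomWalk X P) {p q : Ω → Prop}
    (h : ∀ ω, X 0 ω = 0 → (p ω ↔ q ω)) : P {ω | p ω} = P {ω | q ω} :=
  measure_congr (hX.start.mono fun ω hω ↦ propext (h ω hω))

theorem IsRandomWalk.indepFun_past_future (hX : IsRandomWalk X P) (m : ℕ) :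
    IndepFun (fun ω i ↦ X (min i m) ω - X 0 ω) (fun ω i ↦ X (m + i) ω - X m ω) P := by
  set ξ : ℕ → Ω → (Fin d → ℤ) := fun n ω ↦ X (n + 1) ω - X n ω
  set 𝓕 : Set ℕ → MeasurableSpace Ω := fun S ↦ ⨆ i ∈ S, MeasurableSpace.comap (ξ i) inferInstance
  have indep : Indep (𝓕 (Set.Iio m)) (𝓕 (Set.Ici m)) P :=
    indep_iSup_of_disjoint (fun n ↦ ((hX.measurable _).sub (hX.measurable _)).comap_le) hX.indep
      (Set.Iio_disjoint_Ici le_rfl)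
  have meas {S : Set ℕ} {a b : ℕ} (hab : a ≤ b) (hS : Set.Ico a b ⊆ S) :
      Measurable[𝓕 S] fun ω ↦ X b ω - X a ω := by
    have telescope : (fun ω ↦ X b ω - X a ω) = fun ω ↦ ∑ j ∈ Finset.Ico a b, ξ j ω :=
      funext fun ω ↦ (Finset.sum_Ico_sub (fun j ↦ X j ω) hab).symm
    rw [telescope]
    exact Finset.measurable_fun_sum _ fun j hj ↦ Measurable.of_comap_le
      (le_iSup₂ (f := fun i (_ : i ∈ S) ↦ MeasurableSpace.comap (ξ i) inferInstance) j
        (hS (Finset.mem_Ico.1 hj)))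
  refine indep_of_indep_of_le_left (indep_of_indep_of_le_right indep ?_) ?_
  · exact ((@measurable_pi_iff _ _ _ (𝓕 _) _ _).2 fun i ↦
      meas (Nat.le_add_right m i) Set.Ico_subset_Ici_self).comap_le
  · exact ((@measurable_pi_iff _ _ _ (𝓕 _) _ _).2 fun i ↦
      meas (Nat.zero_le _) fun j hj ↦ hj.2.trans_le (min_le_right i m)).comap_le

theorem measure_prod_mem_of_indepFun [IsFiniteMeasure P] {α β : Type*} [MeasurableSpace α]
    [MeasurableSpace β] {U : Ω → α} {V : Ω → β} (hU : Measurable U) (hV : Measurable V)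
    (h : IndepFun U V P) {S : Set (α × β)} (hS : MeasurableSet S) :
    P {ω | (U ω, V ω) ∈ S} = ∫⁻ u, P {ω | (u, V ω) ∈ S} ∂P.map U := by
  have hprod := (indepFun_iff_map_prod_eq_prod_map_map hU.aemeasurable hV.aemeasurable).1 h
  calc P {ω | (U ω, V ω) ∈ S} = P.map (fun ω ↦ (U ω, V ω)) S :=
      (Measure.map_apply (hU.prodMk hV) hS).symm
    _ = ∫⁻ u, P.map V (Prod.mk u ⁻¹' S) ∂P.map U := by rw [hprod, Measure.prod_apply hS]
    _ = ∫⁻ u, P {ω | (u, V ω) ∈ S} ∂P.map U :=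
      lintegral_congr fun u ↦ Measure.map_apply hV (measurable_prodMk_left hS)

variable [IsProbabilityMeasure P]

theorem IsRandomWalk.measure_path_mem (hX : IsRandomWalk X P) {S : Set (ℕ → (Fin d → ℤ))}
    (hS : MeasurableSet S) (x : Fin d → ℤ) :
    P {ω | (fun i ↦ x + X (i + 1) ω) ∈ S} =
      ∫⁻ z, P {ω | (fun i ↦ x + z + (X (1 + i) ω - X 1 ω)) ∈ S} ∂P.map (X 1) := by
  have hstep : Measurable fun ω ↦ X 1 ω - X 0 ω := (hX.measurable 1).sub (hX.measurable 0)
  have hpath : Measurable fun ω i ↦ X (1 + i) ω - X 1 ω :=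
    measurable_pi_iff.2 fun i ↦ (hX.measurable _).sub (hX.measurable _)
  have indep : IndepFun (fun ω ↦ X 1 ω - X 0 ω) (fun ω i ↦ X (1 + i) ω - X 1 ω) P :=
    (hX.indepFun_past_future 1).comp (φ := fun p : ℕ → (Fin d → ℤ) ↦ p 1)
      (measurable_pi_apply 1) measurable_id
  have hS' : MeasurableSet
      {q : (Fin d → ℤ) × (ℕ → (Fin d → ℤ)) | (fun i ↦ x + q.1 + q.2 i) ∈ S} :=
    (show Measurable fun q : (Fin d → ℤ) × (ℕ → (Fin d → ℤ)) ↦ fun i ↦ x + q.1 + q.2 i by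
      fun_prop) hS
  rw [← hX.map_step 0]
  refine (hX.measure_congr_of_start fun ω hω ↦ ?_).trans
    (measure_prod_mem_of_indepFun hstep hpath indep hS')
  refine iff_of_eq (congrArg (· ∈ S) (funext fun i ↦ ?_))
  simp [hω, add_comm 1 i]

theorem measurableSet_lt_visits (A : Set (Fin d → ℤ)) (n k : ℕ) :
    MeasurableSet {x : ℕ → (Fin d → ℤ) | k < visits A x n} :=
  measurable_visits .of_discrete n measurableSet_Ioi

theorem IsRandomWalk.measure_lt_visits_tail (hX : IsRandomWalk X P) {n k : ℕ}
    {g : (Fin d → ℤ) → ℝ≥0∞}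
    (h : ∀ z, P {ω | k < visits A (fun i ↦ z + (X (1 + i) ω - X 1 ω)) n} = g z) (x : Fin d → ℤ) :
    P {ω | k < visits A (fun i ↦ x + X (i + 1) ω) n} = transition (P.map (X 1)) g x :=
  (hX.measure_path_mem (measurableSet_lt_visits A n k) x).trans (lintegral_congr fun z ↦ h (x + z))

theorem IsRandomWalk.measure_lt_visits (hX : IsRandomWalk X P) (A : Set (Fin d → ℤ)) (n k : ℕ)
    (x : Fin d → ℤ) :
    P {ω | k < visits A (fun i ↦ x + X i ω) n} = visitExpect (P.map (X 1)) A 1 n k x := by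
  induction n, k, x using visitExpect_induction (A := A) generalizing X with
  | mem_zero n x hx =>
    rw [visitExpect_zero_right_of_mem hx, hX.measure_congr_of_start (q := fun _ ↦ True)]
    · simp
    · exact fun ω hω ↦ iff_true_intro (visits_pos_iff.2 ⟨0, n.zero_le, by simpa [hω] using hx⟩)
  | zero_succ k x _ =>
    have not_lt (ω : Ω) : ¬k + 1 < visits A (fun i ↦ x + X i ω) 0 := by
      have := visits_le A (fun i ↦ x + X i ω) 0
      lia
    simp [visitExpect_zero_succ, not_lt]
  | zero_notMem k x hx =>
    rw [visitExpect_zero_left_of_notMem hx, hX.measure_congr_of_start (q := fun _ ↦ False)]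
    · simp
    · intro ω hω
      simp only [iff_false]
      exact fun h ↦ by simpa [hω, hx] using visits_pos_iff.1 (Nat.zero_lt_of_lt h)
  | mem_succ n k ih x hx =>
    rw [visitExpect_succ_succ_of_mem hx,
      ← hX.measure_lt_visits_tail fun z ↦ hX.map_step 1 ▸ ih z (hX.shift 1)]
    refine hX.measure_congr_of_start fun ω hω ↦ ?_
    rw [visits_succ_of_mem (by simpa [hω] using hx), Nat.add_lt_add_iff_right]
  | notMem_succ n k ih x hx =>
    rw [visitExpect_succ_left_of_notMem hx,
      ← hX.measure_lt_visits_tail fun z ↦ hX.map_step 1 ▸ ih z (hX.shift 1)]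
    refine hX.measure_congr_of_start fun ω hω ↦ ?_
    rw [visits_succ_of_notMem (by simpa [hω] using hx)]

theorem IsRandomWalk.measure_exists_eq (hX : IsRandomWalk X P) (y : Fin d → ℤ) :
    P {ω | ∃ s, 0 < s ∧ X s ω = y} = transition (P.map (X 1)) (hitting (P.map (X 1))) (-y) := by
  have exists_iff : {ω | ∃ s, 0 < s ∧ X s ω = y} =
      ⋃ n, {ω | 0 < visits {0} (fun i ↦ -y + X (i + 1) ω) n} := by
    ext ω
    simp only [visits_pos_iff, Set.mem_iUnion, Set.mem_ofPred_eq, Set.mem_singleton_iff,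
      neg_add_eq_zero]
    constructor
    · rintro ⟨s, hs, rfl⟩
      exact ⟨s, s - 1, s.sub_le 1, by rw [Nat.sub_add_cancel hs]⟩
    · rintro ⟨-, j, -, h⟩
      exact ⟨j + 1, j.succ_pos, h.symm⟩
  have mono : Monotone fun n ↦ {ω | 0 < visits {0} (fun i ↦ -y + X (i + 1) ω) n} :=
    fun _ _ h ω hω ↦ lt_of_lt_of_le hω (visits_mono _ _ h)
  rw [exists_iff, mono.measure_iUnion, hitting, transition_balayage]
  exact iSup_congr fun n ↦ hX.measure_lt_visits_tail
    (fun z ↦ hX.map_step 1 ▸ (hX.shift 1).measure_lt_visits {0} n 0 z) (-y)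

theorem IsRandomWalk.hitProb_eq (hX : IsRandomWalk X P) {y : Fin d → ℤ} (hy : y ≠ 0) :
    hitProb X P y = (hitting (P.map (X 1)) (-y)).toReal := by
  rw [hitProb, Measure.real, hX.measure_exists_eq, transition_hitting (neg_ne_zero.2 hy)]

theorem IsRandomWalk.noReturnProb_eq (hX : IsRandomWalk X P) :
    noReturnProb X P =
      1 - (transition (P.map (X 1)) (hitting (P.map (X 1))) 0).toReal := by
  have meas : MeasurableSet {ω | ∃ s, 0 < s ∧ X s ω = 0} :=
    measurableSet_setOfPred.2 <| .exists fun s ↦ .and measurable_const <|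
      measurableSet_setOfPred.1 <| hX.measurable s <| measurableSet_singleton 0
  rw [noReturnProb, ← neg_zero, ← hX.measure_exists_eq, ← Measure.real,
    ← probReal_compl_eq_one_sub meas]
  congr 1
  ext ω
  simp

end Walk

section Tails

variable {d : ℕ} {Ω : Type*} [MeasurableSpace Ω] {P : Measure Ω} [IsProbabilityMeasure P]
  {X : ℕ → Ω → (Fin d → ℤ)}

theorem IsRandomWalk.measure_lt_maxVisits_le (hX : IsRandomWalk X P) (A : Finset (Fin d → ℤ))
    (n k : ℕ) :
    P {ω | k < maxVisits A (fun i ↦ X i ω) n} ≤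
      (n + 1) * ∑ a ∈ A, visitExpect (P.map (X 1)) A 1 n k a := by
  have subset : {ω | k < maxVisits A (fun i ↦ X i ω) n} ⊆ ⋃ j ∈ Finset.range (n + 1), ⋃ a ∈ A,
      {ω | k < visits A (fun i ↦ a + (X (j + i) ω - X j ω)) n} := fun ω hω ↦ by
    obtain ⟨j, hj, a, ha, h⟩ := exists_lt_visits_of_lt_maxVisits hω
    simp only [Set.mem_iUnion, Finset.mem_range]
    exact ⟨j, Nat.lt_succ_of_le hj, a, ha, h⟩
  calc P {ω | k < maxVisits A (fun i ↦ X i ω) n}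
      ≤ ∑ j ∈ Finset.range (n + 1), ∑ a ∈ A,
          P {ω | k < visits A (fun i ↦ a + (X (j + i) ω - X j ω)) n} :=
        (measure_mono subset).trans <| (measure_biUnion_finset_le _ _).trans <|
          Finset.sum_le_sum fun _ _ ↦ measure_biUnion_finset_le _ _
    _ = ∑ _ ∈ Finset.range (n + 1), ∑ a ∈ A, visitExpect (P.map (X 1)) A 1 n k a := by
        simp only [(hX.shift _).measure_lt_visits, hX.map_step]
    _ = (n + 1) * ∑ a ∈ A, visitExpect (P.map (X 1)) A 1 n k a := by simp

theorem IsRandomWalk.measure_visits_le (hX : IsRandomWalk X P) (A : Set (Fin d → ℤ)) (n k : ℕ)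
    (x : Fin d → ℤ) :
    P {ω | visits A (fun i ↦ x + X i ω) n ≤ k} = 1 - visitExpect (P.map (X 1)) A 1 n k x := by
  have meas : Measurable fun ω i ↦ x + X i ω :=
    measurable_pi_iff.2 fun i ↦ (hX.measurable i).const_add x
  rw [← hX.measure_lt_visits]
  refine Eq.trans (congrArg P ?_) (prob_compl_eq_one_sub (meas (measurableSet_lt_visits A n k)))
  ext ω
  simp

theorem measurableSet_forall_visits_block_le (A : Set (Fin d → ℤ)) (a : Fin d → ℤ) (m k B : ℕ) :
    MeasurableSet {p : ℕ → (Fin d → ℤ) |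
      ∀ b < B, visits A (fun i ↦ a + (p (b * m + i) - p (b * m))) m ≤ k} := by
  refine measurableSet_setOfPred.2 <| .forall fun b ↦ .imp measurable_const ?_
  have block : Measurable fun (p : ℕ → (Fin d → ℤ)) i ↦ a + (p (b * m + i) - p (b * m)) := by
    fun_prop
  exact measurableSet_setOfPred.1 <|
    (measurable_visits .of_discrete m).comp block measurableSet_Iic

theorem IsRandomWalk.measure_forall_visits_block_le (hX : IsRandomWalk X P)
    (A : Set (Fin d → ℤ)) (a : Fin d → ℤ) (m k B : ℕ) :
    P {ω | ∀ b < B, visits A (fun i ↦ a + (X (b * m + i) ω - X (b * m) ω)) m ≤ k} =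
      (1 - visitExpect (P.map (X 1)) A 1 m k a) ^ B := by
  induction B generalizing X with
  | zero => simp
  | succ B ih =>
    have first_block (ω : Ω) : visits A (fun i ↦ a + (X (min i m) ω - X 0 ω)) m =
        visits A (fun i ↦ a + (X i ω - X 0 ω)) m :=
      visits_congr fun j hj ↦ by rw [min_eq_left hj]
    have split : {ω | ∀ b < B + 1, visits A (fun i ↦ a + (X (b * m + i) ω - X (b * m) ω)) m ≤ k} =
        (fun ω i ↦ X (min i m) ω - X 0 ω) ⁻¹' {p | visits A (fun i ↦ a + p i) m ≤ k} ∩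
        (fun ω i ↦ X (m + i) ω - X m ω) ⁻¹'
          {p | ∀ b < B, visits A (fun i ↦ a + (p (b * m + i) - p (b * m))) m ≤ k} := by
      ext ω
      have shift_mul (b : ℕ) : m + b * m = (b + 1) * m := by ring
      exact Nat.forall_lt_succ_left.trans (by simp [first_block, ← add_assoc, shift_mul])
    rw [split, (hX.indepFun_past_future m).measure_inter_preimage_eq_mul _ _ ?_
      (measurableSet_forall_visits_block_le A a m k B), pow_succ']
    · congr 1
      · rw [← hX.measure_visits_le]
        refine hX.measure_congr_of_start fun ω hω ↦ ?_
        beta_reduce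
        rw [Set.mem_ofPred_eq, first_block, hω]
        simp
      · exact hX.map_step m ▸ ih (hX.shift m)
    · have : Measurable fun (p : ℕ → (Fin d → ℤ)) i ↦ a + p i := by fun_prop
      exact (measurable_visits .of_discrete m).comp this measurableSet_Iic

theorem IsRandomWalk.measure_maxVisits_le_le (hX : IsRandomWalk X P) (A : Set (Fin d → ℤ))
    (a : Fin d → ℤ) (m n k : ℕ) :
    P {ω | maxVisits A (fun i ↦ X i ω) n ≤ k} ≤
      (1 - visitExpect (P.map (X 1)) A 1 m k a) ^ (n / m) := by
  rw [← hX.measure_forall_visits_block_le]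
  refine measure_mono fun ω (hω : _ ≤ k) b hb ↦ (visits_block_le_maxVisits a ?_).trans hω
  calc b * m + m = (b + 1) * m := by ring
    _ ≤ n / m * m := Nat.mul_le_mul_right _ hb
    _ ≤ n := Nat.div_mul_le_self _ _

end Tails

section Logarithms

variable {c q r : ℝ}

theorem tendsto_div_log_of_two_pow {u : ℕ → ℕ} (hu : Monotone u)
    (h : Tendsto (fun l : ℕ ↦ u (2 ^ l) / Real.log (2 ^ l)) atTop (𝓝 c)) :
    Tendsto (fun n : ℕ ↦ u n / Real.log n) atTop (𝓝 c) := by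
  have log_tendsto : Tendsto (Nat.log 2) atTop atTop :=
    tendsto_atTop.2 fun b ↦ (eventually_ge_atTop (2 ^ b)).mono fun n hn ↦
      Nat.le_log_of_pow_le one_lt_two hn
  have ratio : Tendsto (fun l : ℕ ↦ Real.log (2 ^ l) / Real.log (2 ^ (l + 1))) atTop (𝓝 1) := by
    refine (tendsto_natCast_div_add_atTop (1 : ℝ)).congr fun l ↦ ?_
    rw [Real.log_pow, Real.log_pow, mul_div_mul_right _ _ (Real.log_pos one_lt_two).ne']
    push_cast
    rfl
  have lower := (h.mul ratio).comp log_tendsto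
  have upper := ((h.comp (tendsto_add_atTop_nat 1)).div ratio one_ne_zero).comp log_tendsto
  rw [mul_one] at lower
  rw [div_one] at upper
  refine tendsto_of_tendsto_of_tendsto_of_le_of_le' lower upper ?_ ?_ <;>
    filter_upwards [eventually_ge_atTop 2] with n hn
  all_goals
    have log_pos : 0 < Real.log (2 ^ Nat.log 2 n) :=
      Real.log_pos (one_lt_pow₀ one_lt_two (Nat.log_pos one_lt_two hn).ne')
    have pow_le : 2 ^ Nat.log 2 n ≤ n := Nat.pow_log_le_self 2 (by lia)
    have le_pow : n ≤ 2 ^ (Nat.log 2 n + 1) := (Nat.lt_pow_succ_log_self one_lt_two n).le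
    have log_le : Real.log (2 ^ Nat.log 2 n) ≤ Real.log n :=
      Real.log_le_log (by positivity) (by exact_mod_cast pow_le)
    have le_log : Real.log n ≤ Real.log (2 ^ (Nat.log 2 n + 1)) :=
      Real.log_le_log (by positivity) (by exact_mod_cast le_pow)
  · calc u (2 ^ Nat.log 2 n) / Real.log (2 ^ Nat.log 2 n) *
          (Real.log (2 ^ Nat.log 2 n) / Real.log (2 ^ (Nat.log 2 n + 1)))
        = u (2 ^ Nat.log 2 n) / Real.log (2 ^ (Nat.log 2 n + 1)) :=
          div_mul_div_cancel₀ log_pos.ne'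
      _ ≤ u n / Real.log n := by
          gcongr
          exacts [log_pos.trans_le log_le, hu pow_le]
  · calc (u n : ℝ) / Real.log n
        ≤ u (2 ^ (Nat.log 2 n + 1)) / Real.log (2 ^ Nat.log 2 n) := by
          gcongr
          exact hu le_pow
      _ = u (2 ^ (Nat.log 2 n + 1)) / Real.log (2 ^ (Nat.log 2 n + 1)) /
          (Real.log (2 ^ Nat.log 2 n) / Real.log (2 ^ (Nat.log 2 n + 1))) :=
          (div_div_div_cancel_right₀ (log_pos.trans_le (log_le.trans le_log)).ne' _ _).symm

theorem two_pow_mul_rpow (hr : 0 < r) (q : ℝ) (l : ℕ) :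
    2 ^ l * r ^ (q * Real.log (2 ^ l)) = (2 ^ (1 + q * Real.log r) : ℝ) ^ l := by
  have two_pow : (2 : ℝ) ^ l = Real.exp (Real.log 2 * l) := by
    rw [← Real.rpow_def_of_pos two_pos, Real.rpow_natCast]
  rw [Real.log_pow, two_pow, Real.rpow_def_of_pos hr, Real.rpow_def_of_pos two_pos, ← Real.exp_add,
    ← Real.exp_nat_mul]
  ring_nf

theorem pow_floor_le (hr0 : 0 < r) (hr1 : r ≤ 1) (y : ℝ) : r ^ ⌊y⌋₊ ≤ r⁻¹ * r ^ y := by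
  rw [inv_mul_eq_div, ← Real.rpow_sub_one hr0.ne', ← Real.rpow_natCast]
  exact Real.rpow_le_rpow_of_exponent_ge hr0 hr1 (Nat.sub_one_lt_floor y).le

theorem le_pow_ceil (hr0 : 0 < r) (hr1 : r ≤ 1) {y : ℝ} (hy : 0 ≤ y) : r * r ^ y ≤ r ^ ⌈y⌉₊ := by
  rw [mul_comm, ← Real.rpow_add_one hr0.ne', ← Real.rpow_natCast]
  exact Real.rpow_le_rpow_of_exponent_ge hr0 hr1 (Nat.ceil_lt_add_one hy).le

theorem eventually_le_pow_ceil_mul_div {κ : ℝ} (hκ : 0 < κ) (hr0 : 0 < r) (hr1 : r ≤ 1)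
    (hq0 : 0 < q) (hq : 0 < 1 + q * Real.log r) {m : ℕ} (hm : 0 < m) :
    ∀ᶠ l : ℕ in atTop, (l : ℝ) ≤
      κ * r ^ ⌈q * Real.log (2 ^ l)⌉₊ * (2 ^ l / (m * ⌈q * Real.log (2 ^ l)⌉₊) : ℕ) := by
  have growth := (tendsto_pow_const_div_const_pow_of_one_lt 2
    (Real.one_lt_rpow one_lt_two hq)).const_mul ((1 + κ) * (m * (q * Real.log 2 + 1)))
  rw [mul_zero] at growth
  filter_upwards [growth.eventually_lt_const (mul_pos hκ hr0), eventually_ge_atTop 1] with l hl hl1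
  have one_le : (1 : ℝ) ≤ l := by exact_mod_cast hl1
  have y_pos : 0 < q * Real.log (2 ^ l) :=
    mul_pos hq0 (Real.log_pos (one_lt_pow₀ one_lt_two (by lia)))
  set K := ⌈q * Real.log (2 ^ l)⌉₊
  have K_pos : 0 < K := Nat.ceil_pos.2 y_pos
  have block_pos : (0 : ℝ) < m * K := by positivity
  have block_le : (m * K : ℝ) ≤ m * (q * Real.log 2 + 1) * l := by
    have : (K : ℝ) ≤ q * (l * Real.log 2) + 1 := by
      rw [← Real.log_pow]
      exact (Nat.ceil_lt_add_one y_pos.le).le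
    rw [mul_assoc]
    gcongr
    linarith
  have blocks : (2 ^ l / (m * K) : ℝ) - 1 ≤ (2 ^ l / (m * K) : ℕ) := by
    have := (Nat.sub_one_lt_floor ((2 ^ l : ℕ) / (m * K : ℕ) : ℝ)).le
    rw [Nat.floor_div_eq_div] at this
    exact_mod_cast this
  have main : l + κ ≤ κ * r ^ K * (2 ^ l / (m * K)) := by
    rw [← mul_div_assoc, le_div_iff₀ block_pos]
    calc (l + κ) * (m * K) ≤ ((1 + κ) * l) * (m * (q * Real.log 2 + 1) * l) := by
          gcongr
          nlinarith
      _ = (1 + κ) * (m * (q * Real.log 2 + 1)) * l ^ 2 := by ring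
      _ ≤ κ * r * (2 ^ (1 + q * Real.log r)) ^ l :=
          ((div_lt_iff₀ (by positivity)).1 (by rwa [← mul_div_assoc] at hl)).le
      _ = κ * (r * r ^ (q * Real.log (2 ^ l))) * 2 ^ l := by rw [← two_pow_mul_rpow hr0]; ring
      _ ≤ κ * r ^ K * 2 ^ l := by
          gcongr
          exact le_pow_ceil hr0 hr1 y_pos.le
  have : κ * r ^ K ≤ κ := mul_le_of_le_one_right hκ.le (pow_le_one₀ hr0.le hr1)
  nlinarith [show 0 ≤ κ * r ^ K by positivity]

end Logarithms

section Limit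

variable {Ω : Type*} [MeasurableSpace Ω] {P : Measure Ω}

theorem ae_eventually_notMem_of_geometric {s : ℕ → Set Ω} {D ρ : ℝ≥0∞} (hD : D ≠ ⊤) (hρ : ρ < 1)
    (h : ∀ᶠ l in atTop, P (s l) ≤ D * ρ ^ l) : ∀ᵐ ω ∂P, ∀ᶠ l in atTop, ω ∉ s l := by
  obtain ⟨N, hN⟩ := eventually_atTop.1 h
  have summable : ∑' l, P (s (l + N)) ≠ ⊤ := by
    refine ne_top_of_le_ne_top ?_ (ENNReal.tsum_le_tsum fun l ↦ (hN (l + N) (by lia)).trans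
      (mul_le_mul_right (pow_le_pow_right_of_le_one' hρ.le (Nat.le_add_right l N)) D))
    rw [ENNReal.tsum_mul_left, ENNReal.tsum_geometric]
    exact ENNReal.mul_ne_top hD (ENNReal.inv_ne_top.2 (tsub_pos_of_lt hρ).ne')
  filter_upwards [ae_eventually_notMem summable] with ω hω
  rwa [← map_add_atTop_eq_nat N, eventually_map]

variable [IsProbabilityMeasure P] {d : ℕ} {X : ℕ → Ω → (Fin d → ℤ)} {A : Finset (Fin d → ℤ)}
  {q r : ℝ}

theorem IsRandomWalk.ae_eventually_maxVisits_le (hX : IsRandomWalk X P) (hr0 : 0 < r) (hr1 : r < 1)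
    {D : ℝ≥0∞} (hD : D ≠ ⊤)
    (tail : ∀ n k, ∀ a ∈ A, visitExpect (P.map (X 1)) A 1 n k a ≤ D * .ofReal r ^ k)
    (hq : 1 + q * Real.log r < 0) :
    ∀ᵐ ω ∂P, ∀ᶠ l : ℕ in atTop, maxVisits A (fun i ↦ X i ω) (2 ^ l) ≤ q * Real.log (2 ^ l) := by
  have q_nonneg : 0 ≤ q := by
    by_contra! h
    nlinarith [Real.log_neg hr0 hr1]
  have ρ_lt_one := Real.rpow_lt_one_of_one_lt_of_neg one_lt_two hq
  have bound (l : ℕ) : P {ω | q * Real.log (2 ^ l) < maxVisits A (fun i ↦ X i ω) (2 ^ l)} ≤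
      (2 * A.card * D * .ofReal r⁻¹) * ENNReal.ofReal (2 ^ (1 + q * Real.log r)) ^ l := by
    set K := ⌊q * Real.log (2 ^ l)⌋₊
    calc P {ω | q * Real.log (2 ^ l) < maxVisits A (fun i ↦ X i ω) (2 ^ l)}
        = P {ω | K < maxVisits A (fun i ↦ X i ω) (2 ^ l)} := by
          have y_nonneg : 0 ≤ q * Real.log (2 ^ l) :=
            mul_nonneg q_nonneg (Real.log_nonneg (one_le_pow₀ one_le_two))
          simp only [K, Nat.floor_lt y_nonneg]
      _ ≤ ((2 ^ l : ℕ) + 1) * ∑ a ∈ A, visitExpect (P.map (X 1)) A 1 (2 ^ l) K a :=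
          hX.measure_lt_maxVisits_le A (2 ^ l) K
      _ ≤ (2 * 2 ^ l) * ∑ _a ∈ A, D * .ofReal (r⁻¹ * r ^ (q * Real.log (2 ^ l))) := by
          gcongr with a ha
          · push_cast
            rw [two_mul]
            gcongr
            exact one_le_pow₀ one_le_two
          · refine (tail _ K a ha).trans ?_
            rw [← ENNReal.ofReal_pow hr0.le]
            gcongr
            exact pow_floor_le hr0 hr1.le _
      _ = (2 * A.card * D * .ofReal r⁻¹) * .ofReal (2 ^ l * r ^ (q * Real.log (2 ^ l))) := by
          rw [Finset.sum_const, nsmul_eq_mul, ENNReal.ofReal_mul (by positivity),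
            ENNReal.ofReal_mul (by positivity), ENNReal.ofReal_pow zero_le_two,
            ENNReal.ofReal_ofNat]
          ring
      _ = _ := by rw [two_pow_mul_rpow hr0, ENNReal.ofReal_pow (by positivity)]
  have const_ne_top : 2 * A.card * D * ENNReal.ofReal r⁻¹ ≠ ⊤ := by finiteness
  filter_upwards [ae_eventually_notMem_of_geometric const_ne_top (by simpa using ρ_lt_one)
    (.of_forall bound)] with ω hω
  exact hω.mono fun l hl ↦ not_lt.1 hl

theorem IsRandomWalk.ae_eventually_le_maxVisits (hX : IsRandomWalk X P) (hr0 : 0 < r) (hr1 : r ≤ 1)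
    {κ : ℝ} (hκ : 0 < κ) {m : ℕ} (hm : 0 < m) {a : Fin d → ℤ}
    (tail : ∀ k, .ofReal (κ * r ^ k) ≤ visitExpect (P.map (X 1)) A 1 (m * k) k a)
    (hq0 : 0 < q) (hq : 0 < 1 + q * Real.log r) :
    ∀ᵐ ω ∂P, ∀ᶠ l : ℕ in atTop, q * Real.log (2 ^ l) ≤ maxVisits A (fun i ↦ X i ω) (2 ^ l) := by
  have bound : ∀ᶠ l : ℕ in atTop,
      P {ω | maxVisits A (fun i ↦ X i ω) (2 ^ l) ≤ ⌈q * Real.log (2 ^ l)⌉₊} ≤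
        1 * ENNReal.ofReal (Real.exp (-1)) ^ l := by
    filter_upwards [eventually_le_pow_ceil_mul_div hκ hr0 hr1 hq0 hq hm] with l hl
    set K := ⌈q * Real.log (2 ^ l)⌉₊
    set B := 2 ^ l / (m * K)
    calc P {ω | maxVisits A (fun i ↦ X i ω) (2 ^ l) ≤ K}
        ≤ (1 - visitExpect (P.map (X 1)) A 1 (m * K) K a) ^ B :=
          hX.measure_maxVisits_le_le A a (m * K) (2 ^ l) K
      _ ≤ (1 - .ofReal (κ * r ^ K)) ^ B := by gcongr; exact tail K
      _ = .ofReal (1 - κ * r ^ K) ^ B := by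
          rw [ENNReal.ofReal_sub _ (by positivity), ENNReal.ofReal_one]
      _ ≤ .ofReal (Real.exp (-(κ * r ^ K))) ^ B := by
          gcongr
          exact Real.one_sub_le_exp_neg _
      _ = .ofReal (Real.exp (-(κ * r ^ K * B))) := by
          rw [← ENNReal.ofReal_pow (Real.exp_nonneg _), ← Real.exp_nat_mul]
          ring_nf
      _ ≤ .ofReal (Real.exp (l * (-1))) := by gcongr; linarith
      _ = 1 * .ofReal (Real.exp (-1)) ^ l := by
          rw [one_mul, Real.exp_nat_mul, ENNReal.ofReal_pow (Real.exp_nonneg _)]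
  filter_upwards [ae_eventually_notMem_of_geometric ENNReal.one_ne_top (by simp) bound] with ω hω
  filter_upwards [hω] with l hl
  exact (Nat.le_ceil _).trans (by exact_mod_cast (not_le.1 hl).le)

end Limit

section Eigenfunction

variable {E : Type*} [AddCommGroup E] [MeasurableSpace E] [DiscreteMeasurableSpace E]
  {ν : Measure E} {A : Finset E} {φ : E → ℝ≥0∞} {C r s : ℝ≥0∞}

theorem exists_visitExpect_one_le (hC : C ≠ ⊤) (le_C : ∀ x, φ x ≤ C) (ne_zero : ∀ x ∈ A, φ x ≠ 0)
    (hoff : ∀ x ∉ A, transition ν φ x ≤ φ x) (hon : ∀ x ∈ A, transition ν φ x ≤ r * φ x) :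
    ∃ D ≠ ⊤, ∀ n k x, visitExpect ν A 1 n k x ≤ D * r ^ k := by
  have M_ne_top : A.sup (fun a ↦ (φ a)⁻¹) ≠ ⊤ :=
    ((Finset.sup_lt_iff ENNReal.zero_lt_top).2 fun a ha ↦
      by simpa [pos_iff_ne_zero] using ne_zero a ha).ne
  set M := A.sup fun a ↦ (φ a)⁻¹
  refine ⟨M * C, ENNReal.mul_ne_top M_ne_top hC, fun n k x ↦ ?_⟩
  calc visitExpect ν A 1 n k x ≤ visitExpect ν A (fun y ↦ M * φ y) n k x := by
        refine visitExpect_mono (fun a ha ↦ ?_) n k x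
        rw [Pi.one_apply,
          ← ENNReal.inv_mul_cancel (ne_zero a ha) (ne_top_of_le_ne_top hC (le_C a))]
        gcongr
        exact Finset.le_sup (f := fun a ↦ (φ a)⁻¹) ha
    _ = M * visitExpect ν A φ n k x := visitExpect_const_mul M n k x
    _ ≤ M * (r ^ k * C) := by
        gcongr
        exact (visitExpect_le_pow_mul hoff hon n k x).trans (by gcongr; exact le_C x)
    _ = M * C * r ^ k := by ring

theorem exists_le_visitExpect_one (hC : C ≠ ⊤) (le_C : ∀ x, φ x ≤ C) (ne_zero : ∀ x ∈ A, φ x ≠ 0)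
    (bal : balayage ν A φ = φ) (hon : ∀ x ∈ A, transition ν φ x = r * φ x) (hs : s < r) :
    ∃ m, 0 < m ∧ ∀ k, ∀ x ∈ A, C⁻¹ * φ x * s ^ k ≤ visitExpect ν A 1 (m * k) k x := by
  have eventually_le (x) (hx : x ∈ A) :
      ∀ᶠ m in atTop, s * φ x ≤ transition ν (visitExpect ν A φ m 0) x := by
    have : s * φ x < ⨆ m, transition ν (visitExpect ν A φ m 0) x := by
      rw [← transition_balayage, bal, hon x hx]
      exact ENNReal.mul_lt_mul_left (ne_zero x hx) (ne_top_of_le_ne_top hC (le_C x)) hs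
    obtain ⟨m, hm⟩ := lt_iSup_iff.1 this
    exact (eventually_ge_atTop m).mono fun n hn ↦
      hm.le.trans (transition_mono (visitExpect_mono_time 0 hn) x)
  obtain ⟨m, hm⟩ := ((eventually_all_finset A).2 eventually_le).exists
  refine ⟨m + 1, m.succ_pos, fun k x hx ↦ ?_⟩
  calc C⁻¹ * φ x * s ^ k = C⁻¹ * (s ^ k * visitExpect ν A φ 0 0 x) := by
        rw [visitExpect_zero_right_of_mem (Finset.mem_coe.2 hx)]
        ring
    _ ≤ C⁻¹ * visitExpect ν A φ ((m + 1) * k + 0) k x := by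
        gcongr
        exact pow_mul_visitExpect_le hm k 0 x
    _ = visitExpect ν A (fun y ↦ C⁻¹ * φ y) ((m + 1) * k) k x :=
        (visitExpect_const_mul _ _ _ _).symm
    _ ≤ visitExpect ν A 1 ((m + 1) * k) k x := by
        refine visitExpect_mono (fun a _ ↦ ?_) _ _ _
        rw [Pi.one_apply, mul_comm, ← div_eq_mul_inv]
        exact ENNReal.div_le_of_le_mul (by simpa using le_C a)

variable [IsProbabilityMeasure ν] {w : E → ℝ} {Λ : ℝ} {x : E}

theorem potential_of_eigenvector (hw : ∀ x ∈ A, 0 ≤ w x)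
    (eigen : ∀ x ∈ A, ∑ a ∈ A, w a * (hitting ν (x - a)).toReal = Λ * w x) (hx : x ∈ A) :
    potential ν A (fun a ↦ .ofReal (w a)) x = .ofReal (Λ * w x) := by
  rw [← eigen x hx, ENNReal.ofReal_sum_of_nonneg fun a ha ↦ by have := hw a ha; positivity]
  refine Finset.sum_congr rfl fun a ha ↦ ?_
  rw [ENNReal.ofReal_mul (hw a ha), ENNReal.ofReal_toReal (hitting_ne_top _)]

theorem transition_potential_of_eigenvector (hw : ∀ x ∈ A, 0 ≤ w x) (hΛ_pos : 0 < Λ)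
    (hΛ : 1 - (transition ν (hitting ν) 0).toReal ≤ Λ)
    (eigen : ∀ x ∈ A, ∑ a ∈ A, w a * (hitting ν (x - a)).toReal = Λ * w x) (hx : x ∈ A) :
    transition ν (potential ν A fun a ↦ .ofReal (w a)) x =
      .ofReal (1 - (1 - (transition ν (hitting ν) 0).toReal) / Λ) *
        potential ν A (fun a ↦ .ofReal (w a)) x := by
  have add_eq := transition_potential_add (ν := ν) (w := fun a ↦ .ofReal (w a)) hx
  have u_ne_top : transition ν (hitting ν) (0 : E) ≠ ⊤ :=
    ne_top_of_le_ne_top ENNReal.one_ne_top (transition_hitting_le_one 0)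
  rw [← ENNReal.ofReal_toReal u_ne_top] at add_eq
  set u := (transition ν (hitting ν) 0).toReal
  have u_nonneg : 0 ≤ u := ENNReal.toReal_nonneg
  have w_nonneg : 0 ≤ w x := hw x hx
  have r_nonneg : 0 ≤ 1 - (1 - u) / Λ := sub_nonneg.2 ((div_le_one hΛ_pos).2 hΛ)
  refine (ENNReal.add_left_inj (ENNReal.ofReal_ne_top (r := w x))).1 (add_eq.trans ?_)
  rw [potential_of_eigenvector hw eigen hx, ← ENNReal.ofReal_mul w_nonneg,
    ← ENNReal.ofReal_mul r_nonneg, ← ENNReal.ofReal_add (by positivity) (by positivity),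
    ← ENNReal.ofReal_add (by positivity) w_nonneg]
  congr 1
  field_simp
  ring

variable {d : ℕ} {Ω : Type*} [MeasurableSpace Ω] {P : Measure Ω} [IsProbabilityMeasure P]
  {X : ℕ → Ω → (Fin d → ℤ)}

theorem tendsto_maxOccupationRatio_of_forall_rat {x : ℕ → (Fin d → ℤ)} {A : Set (Fin d → ℤ)} {c : ℝ}
    (hc : 0 < c)
    (upper : ∀ q : ℚ, c < q →
      ∀ᶠ l : ℕ in atTop, maxVisits A x (2 ^ l) ≤ q * Real.log (2 ^ l))
    (lower : ∀ q : ℚ, 0 < q → q < c →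
      ∀ᶠ l : ℕ in atTop, q * Real.log (2 ^ l) ≤ maxVisits A x (2 ^ l)) :
    Tendsto (maxOccupationRatio x A) atTop (𝓝 c) := by
  rw [funext (maxOccupationRatio_eq A x)]
  have log_pos : ∀ᶠ l : ℕ in atTop, 0 < Real.log (2 ^ l) :=
    (eventually_gt_atTop 0).mono fun l hl ↦ Real.log_pos (one_lt_pow₀ one_lt_two hl.ne')
  refine tendsto_div_log_of_two_pow (maxVisits_mono A x)
    (tendsto_order.2 ⟨fun b hb ↦ ?_, fun b hb ↦ ?_⟩)
  · obtain ⟨q, hbq, hqc⟩ := exists_rat_btwn (max_lt hb hc)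
    filter_upwards [log_pos, lower q (by exact_mod_cast (le_max_right b 0).trans_lt hbq) hqc]
      with l hlog hl
    exact ((le_max_left b 0).trans_lt hbq).trans_le ((le_div_iff₀ hlog).2 hl)
  · obtain ⟨q, hcq, hqb⟩ := exists_rat_btwn hb
    filter_upwards [log_pos, upper q hcq] with l hlog hl
    exact ((div_le_iff₀ hlog).2 hl).trans_lt hqb

theorem IsRandomWalk.tendsto_maxOccupationRatio_of_eigenfunction (hX : IsRandomWalk X P)
    {A : Finset (Fin d → ℤ)} (hA : A.Nonempty) {φ : (Fin d → ℤ) → ℝ≥0∞} {C : ℝ≥0∞} (hC : C ≠ ⊤)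
    (le_C : ∀ x, φ x ≤ C) (ne_zero : ∀ x ∈ A, φ x ≠ 0) (bal : balayage (P.map (X 1)) A φ = φ)
    {r : ℝ} (hr0 : 0 < r) (hr1 : r < 1)
    (hon : ∀ x ∈ A, transition (P.map (X 1)) φ x = .ofReal r * φ x) :
    ∀ᵐ ω ∂P, Tendsto (maxOccupationRatio (fun n ↦ X n ω) A) atTop (𝓝 (-1 / Real.log r)) := by
  have := hX.isProbabilityMeasure_map
  have log_neg : Real.log r < 0 := Real.log_neg hr0 hr1
  have upper (q : ℚ) (hq : -1 / Real.log r < q) : ∀ᵐ ω ∂P, ∀ᶠ l : ℕ in atTop,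
      maxVisits A (fun i ↦ X i ω) (2 ^ l) ≤ q * Real.log (2 ^ l) := by
    have hoff (x) (hx : x ∉ A) : transition (P.map (X 1)) φ x ≤ φ x := by
      simpa only [bal] using (transition_balayage_of_notMem (f := φ) (ν := P.map (X 1))
        (Finset.mem_coe.not.2 hx)).le
    obtain ⟨D, hD, tail⟩ := exists_visitExpect_one_le hC le_C ne_zero hoff fun x hx ↦ (hon x hx).le
    exact hX.ae_eventually_maxVisits_le hr0 hr1 hD (fun n k a _ ↦ tail n k a)
      (by linarith [(div_lt_iff_of_neg log_neg).1 hq])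
  have lower (q : ℚ) (hq0 : 0 < q) (hq : q < -1 / Real.log r) : ∀ᵐ ω ∂P, ∀ᶠ l : ℕ in atTop,
      q * Real.log (2 ^ l) ≤ maxVisits A (fun i ↦ X i ω) (2 ^ l) := by
    have q_pos : (0 : ℝ) < q := by exact_mod_cast hq0
    obtain ⟨s, hs, hsr⟩ : ∃ s, Real.exp (-1 / q) < s ∧ s < r := by
      refine exists_between ((Real.lt_log_iff_exp_lt hr0).1 ((div_lt_iff₀ q_pos).2 ?_))
      linarith [(lt_div_iff_of_neg log_neg).1 hq]
    have s_pos : 0 < s := (Real.exp_pos _).trans hs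
    obtain ⟨a, ha⟩ := hA
    obtain ⟨m, hm, tail⟩ := exists_le_visitExpect_one hC le_C ne_zero bal hon
      ((ENNReal.ofReal_lt_ofReal_iff hr0).2 hsr)
    have κ_ne_top : C⁻¹ * φ a ≠ ⊤ := ne_top_of_le_ne_top ENNReal.one_ne_top <| by
      simpa using (tail 0 a ha).trans (visitExpect_one_le_one _ _ _)
    have κ_pos : 0 < (C⁻¹ * φ a).toReal :=
      ENNReal.toReal_pos (mul_ne_zero (ENNReal.inv_ne_zero.2 hC) (ne_zero a ha)) κ_ne_top
    refine hX.ae_eventually_le_maxVisits (a := a) s_pos (hsr.trans hr1).le κ_pos hm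
      (fun k ↦ ?_) q_pos ?_
    · rw [ENNReal.ofReal_mul κ_pos.le, ENNReal.ofReal_toReal κ_ne_top, ENNReal.ofReal_pow s_pos.le]
      exact tail k a ha
    · linarith [(div_lt_iff₀ q_pos).1 ((Real.lt_log_iff_exp_lt s_pos).2 hs)]
  have upper_all := ae_all_iff.2 fun q : ℚ ↦ ae_all_iff.2 (upper q)
  have lower_all := ae_all_iff.2 fun q : ℚ ↦ ae_all_iff.2 fun h ↦ ae_all_iff.2 (lower q h)
  filter_upwards [upper_all, lower_all] with ω hU hL
  exact tendsto_maxOccupationRatio_of_forall_rat (div_pos_of_neg_of_neg (by norm_num) log_neg) hU hL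

theorem IsRandomWalk.tendsto_maxOccupationRatio_of_eigenvector (hX : IsRandomWalk X P)
    (htrans : IsTransient X P) {A : Finset (Fin d → ℤ)} (hA : A.Nonempty)
    {w : (Fin d → ℤ) → ℝ} (hw : ∀ x ∈ A, 0 < w x) {Λ : ℝ} (hΛ : noReturnProb X P < Λ)
    (eigen : ∀ x ∈ A, ∑ a ∈ A, w a * (hitting (P.map (X 1)) (x - a)).toReal = Λ * w x) :
    ∀ᵐ ω ∂P, Tendsto (maxOccupationRatio (fun n ↦ X n ω) A) atTop
      (𝓝 (-1 / Real.log (1 - noReturnProb X P / Λ))) := by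
  have := hX.isProbabilityMeasure_map
  have Λ_pos : 0 < Λ := htrans.trans hΛ
  have w_nonneg (x) (hx : x ∈ A) : 0 ≤ w x := (hw x hx).le
  refine hX.tendsto_maxOccupationRatio_of_eigenfunction hA
    (φ := potential (P.map (X 1)) A fun a ↦ .ofReal (w a))
    (ENNReal.sum_ne_top.2 fun a _ ↦ ENNReal.ofReal_ne_top) potential_le (fun x hx ↦ ?_)
    balayage_potential (sub_pos.2 ((div_lt_one Λ_pos).2 hΛ)) (sub_lt_self 1 (div_pos htrans Λ_pos))
    fun x hx ↦ ?_
  · rw [potential_of_eigenvector w_nonneg eigen hx, ENNReal.ofReal_ne_zero_iff]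
    exact mul_pos Λ_pos (hw x hx)
  · rw [hX.noReturnProb_eq] at hΛ ⊢
    exact transition_potential_of_eigenvector w_nonneg Λ_pos hΛ.le eigen hx

end Eigenfunction

section Pair

variable {d : ℕ} {Ω : Type*} [MeasurableSpace Ω] {P : Measure Ω}
  {X : ℕ → Ω → (Fin d → ℤ)}

theorem IsRandomWalk.map_neg_of_isSymmetric (hX : IsRandomWalk X P) (hsymm : IsSymmetric X P) :
    (P.map (X 1)).map Neg.neg = P.map (X 1) := by
  rw [Measure.map_map measurable_neg (hX.measurable 1)]
  exact hsymm.map_eq.symm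

variable [IsProbabilityMeasure P]

theorem IsRandomWalk.noReturnProb_lt_one (hX : IsRandomWalk X P)
    (hsymm : (P.map (X 1)).map Neg.neg = P.map (X 1)) : noReturnProb X P < 1 := by
  have := hX.isProbabilityMeasure_map
  rw [hX.noReturnProb_eq, sub_lt_self_iff]
  exact ENNReal.toReal_pos (transition_hitting_zero_pos hsymm).ne'
    (ne_top_of_le_ne_top ENNReal.one_ne_top (transition_hitting_le_one 0))

theorem IsRandomWalk.tendsto_maxOccupationRatio_pair (hX : IsRandomWalk X P)
    (hsymm : IsSymmetric X P) (htrans : IsTransient X P) {y : Fin d → ℤ} (hy : y ≠ 0) :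
    ∀ᵐ ω ∂P, Tendsto (maxOccupationRatio (fun n ↦ X n ω) {0, y}) atTop
      (𝓝 (-1 / Real.log (1 - noReturnProb X P / (1 + hitProb X P y)))) := by
  have map_neg := hX.map_neg_of_isSymmetric hsymm
  have γ_lt : noReturnProb X P < 1 + hitProb X P y :=
    (hX.noReturnProb_lt_one map_neg).trans_le (le_add_of_nonneg_right measureReal_nonneg)
  rw [← Finset.coe_pair]
  refine hX.tendsto_maxOccupationRatio_of_eigenvector htrans (Finset.insert_nonempty 0 {y})
    (w := 1) (fun _ _ ↦ one_pos) γ_lt fun x hx ↦ ?_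
  rw [hX.hitProb_eq hy]
  obtain rfl | rfl : x = 0 ∨ x = y := by simpa using hx
  · simp [Finset.sum_pair hy.symm, hitting_zero]
  · simp [Finset.sum_pair hy.symm, hitting_zero, hitting_neg map_neg, add_comm]

end Pair

section UnitVec

variable {d : ℕ}

/-- The `2d` unit vectors `±e_i` of `ℤ^d`, indexed by the coordinate and the sign. -/
def unitVec (p : Fin d × ℤˣ) : Fin d → ℤ :=
  Pi.single p.1 (p.2 : ℤ)

theorem unitVec_ne_zero (p : Fin d × ℤˣ) : unitVec p ≠ 0 := by
  simp [unitVec]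

theorem neg_unitVec (p : Fin d × ℤˣ) : -unitVec p = unitVec (p.1, -p.2) := by
  simp [unitVec, Pi.single_neg]

theorem unitVec_injective : Function.Injective (unitVec (d := d)) := by
  rintro ⟨i, ε⟩ ⟨j, δ⟩ h
  obtain rfl : i = j := by
    by_contra hij
    simpa [unitVec, hij] using congrFun h i
  simpa [unitVec, Units.val_inj] using h

/-- The unit sphere of `ℤ^d` as a finite set. -/
def unitVectors (d : ℕ) : Finset (Fin d → ℤ) :=
  Finset.univ.map ⟨unitVec, unitVec_injective⟩

theorem mem_unitVectors {x : Fin d → ℤ} : x ∈ unitVectors d ↔ ∃ p, unitVec p = x := by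
  simp [unitVectors]

theorem coe_unitVectors : (unitVectors d : Set (Fin d → ℤ)) = unitSphere d := by
  ext x
  simp only [Finset.mem_coe, mem_unitVectors, unitSphere, Set.mem_ofPred_eq, Prod.exists]
  refine exists_congr fun i ↦ ⟨?_, ?_⟩
  · rintro ⟨ε, rfl⟩
    obtain rfl | rfl := Int.units_eq_one_or ε <;> simp [unitVec, Pi.single_neg]
  · rintro (rfl | rfl)
    exacts [⟨1, rfl⟩, ⟨-1, by simp [unitVec, Pi.single_neg]⟩]

theorem zero_notMem_unitVectors : (0 : Fin d → ℤ) ∉ unitVectors d := by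
  simp [mem_unitVectors, unitVec_ne_zero]

theorem coe_insert_unitVectors :
    ((insert 0 (unitVectors d) : Finset (Fin d → ℤ)) : Set (Fin d → ℤ)) = unitBall d := by
  rw [Finset.coe_insert, coe_unitVectors, unitBall]

theorem unitVec_mem_unitSphere (p : Fin d × ℤˣ) : unitVec p ∈ unitSphere d := by
  rw [← coe_unitVectors]
  exact mem_unitVectors.2 ⟨p, rfl⟩

theorem card_sign_prod : Fintype.card (Fin d × ℤˣ) = 2 * d := by
  simp [mul_comm]

end UnitVec

section SimpleStep

variable {d : ℕ}

/-- The uniform distribution on the `2d` unit vectors of `ℤ^d`. -/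
noncomputable def simpleStep (d : ℕ) : Measure (Fin d → ℤ) :=
  (2 * d : ℝ≥0∞)⁻¹ • ∑ p : Fin d × ℤˣ, Measure.dirac (unitVec p)

theorem transition_simpleStep (f : (Fin d → ℤ) → ℝ≥0∞) (x : Fin d → ℤ) :
    transition (simpleStep d) f x = (2 * d : ℝ≥0∞)⁻¹ * ∑ p, f (x + unitVec p) := by
  simp [transition, simpleStep, lintegral_smul_measure, lintegral_finsetSum_measure]

instance [NeZero d] : IsProbabilityMeasure (simpleStep d) where
  measure_univ := by
    have hd : (2 * d : ℝ≥0∞) ≠ 0 := by simp [NeZero.ne d]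
    have sum_one : ∑ p : Fin d × ℤˣ, Measure.dirac (unitVec p) Set.univ = (2 * d : ℝ≥0∞) := by
      simp [mul_comm]
    rw [simpleStep, Measure.smul_apply, Measure.finsetSum_apply, sum_one, smul_eq_mul,
      ENNReal.inv_mul_cancel hd (by finiteness)]

theorem simpleStep_singleton_unitVec (p : Fin d × ℤˣ) :
    simpleStep d {unitVec p} = (2 * d : ℝ≥0∞)⁻¹ := by
  simp [simpleStep, Measure.finsetSum_apply, Set.indicator_apply, unitVec_injective.eq_iff]

theorem simpleStep_map {σ : (Fin d → ℤ) ≃+ (Fin d → ℤ)} (e : Equiv.Perm (Fin d × ℤˣ))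
    (he : ∀ p, σ (unitVec p) = unitVec (e p)) : (simpleStep d).map σ = simpleStep d := by
  rw [simpleStep, Measure.map_smul, Measure.map_finset_sum' .of_discrete]
  simp only [Measure.map_dirac' Measurable.of_discrete, he]
  rw [Equiv.sum_comp e fun p ↦ Measure.dirac (unitVec p)]

theorem simpleStep_map_neg : (simpleStep d).map Neg.neg = simpleStep d :=
  simpleStep_map (σ := AddEquiv.neg _) ((Equiv.refl _).prodCongr (Equiv.neg _)) neg_unitVec

theorem hitting_simpleStep_unitVec [NeZero d] (q : Fin d × ℤˣ) :
    hitting (simpleStep d) (unitVec q) = transition (simpleStep d) (hitting (simpleStep d)) 0 := by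
  have permute (π : Equiv.Perm (Fin d)) (p : Fin d × ℤˣ) :
      hitting (simpleStep d) (unitVec (π p.1, p.2)) = hitting (simpleStep d) (unitVec p) := by
    have hσ (p : Fin d × ℤˣ) : (LinearEquiv.funCongrLeft ℤ ℤ π.symm).toAddEquiv (unitVec p) =
        unitVec (π p.1, p.2) := Pi.single_comp_equiv π.symm _ _
    rw [← hσ, hitting_map (simpleStep_map (π.prodCongr (Equiv.refl _)) hσ)]
  have negate (p : Fin d × ℤˣ) :
      hitting (simpleStep d) (unitVec (p.1, -p.2)) = hitting (simpleStep d) (unitVec p) := by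
    rw [← neg_unitVec, hitting_neg simpleStep_map_neg]
  have const (p : Fin d × ℤˣ) :
      hitting (simpleStep d) (unitVec p) = hitting (simpleStep d) (unitVec q) := by
    rw [← permute (Equiv.swap p.1 q.1), Equiv.swap_apply_left]
    obtain h | h := eq_or_ne p.2 q.2
    · rw [h]
    · rw [Int.units_ne_iff_eq_neg.1 h, negate]
  have hd : (2 * d : ℝ≥0∞) ≠ 0 := by simp [NeZero.ne d]
  rw [transition_simpleStep]
  simp only [zero_add, const, Finset.sum_const, Finset.card_univ, card_sign_prod, nsmul_eq_mul]
  push_cast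
  rw [← mul_assoc, ENNReal.inv_mul_cancel hd (by finiteness), one_mul]

theorem transition_hitting_simpleStep [NeZero d] {x : Fin d → ℤ} (hx : x ∈ unitBall d) :
    transition (simpleStep d) (hitting (simpleStep d)) x =
      transition (simpleStep d) (hitting (simpleStep d)) 0 := by
  rw [← coe_insert_unitVectors, Finset.mem_coe, Finset.mem_insert, mem_unitVectors] at hx
  obtain rfl | ⟨p, rfl⟩ := hx
  · rfl
  · rw [transition_hitting (unitVec_ne_zero p), hitting_simpleStep_unitVec]

theorem sum_unitVectors_hitting [NeZero d] {x : Fin d → ℤ} (hx : x ∈ unitBall d) :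
    ∑ a ∈ unitVectors d, (hitting (simpleStep d) (x - a)).toReal =
      2 * d * (transition (simpleStep d) (hitting (simpleStep d)) 0).toReal := by
  have hd : (2 * d : ℝ) ≠ 0 := by simp [NeZero.ne d]
  calc ∑ a ∈ unitVectors d, (hitting (simpleStep d) (x - a)).toReal
      = ∑ p, (hitting (simpleStep d) (x + unitVec p)).toReal := by
        rw [unitVectors, Finset.sum_map]
        refine Fintype.sum_equiv ((Equiv.refl _).prodCongr (Equiv.neg _)) _ _ fun p ↦ ?_
        rw [Function.Embedding.coeFn_mk, sub_eq_add_neg, neg_unitVec]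
        rfl
    _ = 2 * d * (transition (simpleStep d) (hitting (simpleStep d)) x).toReal := by
        rw [transition_simpleStep, ENNReal.toReal_mul, ENNReal.toReal_sum fun _ _ ↦
          hitting_ne_top _, ENNReal.toReal_inv, ENNReal.toReal_mul, ENNReal.toReal_ofNat,
          ENNReal.toReal_natCast, mul_inv_cancel_left₀ hd]
    _ = _ := by rw [transition_hitting_simpleStep hx]

theorem inv_two_mul_le_transition_hitting [NeZero d] :
    (2 * d : ℝ≥0∞)⁻¹ ≤ transition (simpleStep d) (hitting (simpleStep d)) 0 := by
  have := measure_singleton_neg_le_hitting (ν := simpleStep d) (unitVec_ne_zero (0, 1))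
  rwa [neg_unitVec, simpleStep_singleton_unitVec, hitting_simpleStep_unitVec] at this

end SimpleStep

section Lyapunov

variable {d : ℕ}

theorem dotProduct_self_add_unitVec (x : Fin d → ℤ) (p : Fin d × ℤˣ) :
    (x + unitVec p) ⬝ᵥ (x + unitVec p) = x ⬝ᵥ x + (1 + 2 * p.2 * x p.1) := by
  have unit_sq : unitVec p ⬝ᵥ unitVec p = 1 := by
    simp [unitVec, ← Units.val_mul, Int.units_mul_self]
  rw [add_dotProduct, dotProduct_add, dotProduct_add, unit_sq, dotProduct_comm (unitVec p) x,
    unitVec, dotProduct_single]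
  ring

theorem dotProduct_self_nonneg (x : Fin d → ℤ) : 0 ≤ x ⬝ᵥ x :=
  Finset.sum_nonneg fun i _ ↦ mul_self_nonneg (x i)

theorem rpow_neg_third_le {s : ℝ} (hs : |s| ≤ 1 / 10) :
    (1 + s) ^ (-(1 / 3) : ℝ) ≤ 1 - s / 3 + s ^ 2 / 4 := by
  obtain ⟨lower, upper⟩ := abs_le.1 hs
  set w := 1 - s / 3 + s ^ 2 / 4 with hw
  have pos : 0 < 1 + s := by linarith
  have w_nonneg : 0 ≤ w := by nlinarith [sq_nonneg s]
  have cube : (1 + s)⁻¹ ≤ w ^ 3 := by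
    have s_sq : s ^ 2 ≤ 1 / 100 := by nlinarith
    have quotient_nonneg : 0 ≤ 1 / 12 + 59 / 108 * s - 115 / 432 * s ^ 2 +
        s ^ 2 * s * (5 / 24 - 3 / 64 * s + 1 / 64 * s ^ 2) := by
      have s_cube : -(1 / 1000) ≤ s ^ 2 * s := by nlinarith [sq_nonneg s]
      nlinarith [sq_nonneg s]
    rw [inv_le_iff_one_le_mul₀ pos]
    calc (1 : ℝ) ≤ 1 + s ^ 2 * (1 / 12 + 59 / 108 * s - 115 / 432 * s ^ 2 +
          s ^ 2 * s * (5 / 24 - 3 / 64 * s + 1 / 64 * s ^ 2)) :=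
          le_add_of_nonneg_right (by positivity)
      _ = w ^ 3 * (1 + s) := by rw [hw]; ring
  calc (1 + s) ^ (-(1 / 3) : ℝ) = ((1 + s)⁻¹) ^ ((3 : ℕ) : ℝ)⁻¹ := by
        rw [Real.inv_rpow pos.le, ← Real.rpow_neg pos.le]; norm_num
    _ ≤ (w ^ 3) ^ ((3 : ℕ) : ℝ)⁻¹ := by gcongr
    _ = w := Real.pow_rpow_inv_natCast w_nonneg three_ne_zero

/-- The function `(|x|² + 120)^{-1/3}`, superharmonic for the simple random walk if `d ≥ 3`: the
exponent is strictly weaker than that of Newton's potential `|x|^{2-d}`, and the shift by `120`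
keeps the relative change of `|x|² + 120` in one step within `1 / 10`. -/
noncomputable def lyapunov (x : Fin d → ℤ) : ℝ :=
  ((x ⬝ᵥ x : ℤ) + 120 : ℝ) ^ (-(1 / 3) : ℝ)

theorem lyapunov_pos (x : Fin d → ℤ) : 0 < lyapunov x := by
  have : (0 : ℝ) ≤ (x ⬝ᵥ x : ℤ) := by exact_mod_cast dotProduct_self_nonneg x
  exact Real.rpow_pos_of_pos (by linarith) _

theorem lyapunov_add_unitVec_le (x : Fin d → ℤ) (p : Fin d × ℤˣ) {s : ℝ}
    (hs : s = (1 + 2 * p.2 * x p.1) / ((x ⬝ᵥ x : ℤ) + 120)) :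
    lyapunov (x + unitVec p) ≤ lyapunov x * (1 - s / 3 + s ^ 2 / 4) := by
  have coord_le : (x p.1 : ℝ) ^ 2 ≤ (x ⬝ᵥ x : ℤ) := by
    have : x p.1 * x p.1 ≤ x ⬝ᵥ x :=
      Finset.single_le_sum (fun i _ ↦ mul_self_nonneg (x i)) (Finset.mem_univ p.1)
    rw [sq]
    exact_mod_cast this
  have R_pos : (0 : ℝ) < (x ⬝ᵥ x : ℤ) + 120 := by nlinarith [sq_nonneg (x p.1 : ℝ)]
  have s_le : |s| ≤ 1 / 10 := by
    rw [hs, abs_div, abs_of_pos R_pos, div_le_iff₀ R_pos, abs_le]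
    obtain h | h := Int.units_eq_one_or p.2 <;> rw [h] <;> push_cast <;>
      constructor <;> nlinarith [sq_nonneg ((x p.1 : ℝ) - 10), sq_nonneg ((x p.1 : ℝ) + 10)]
  have step : (((x + unitVec p) ⬝ᵥ (x + unitVec p) : ℤ) : ℝ) + 120 =
      ((x ⬝ᵥ x : ℤ) + 120) * (1 + s) := by
    rw [dotProduct_self_add_unitVec, hs]
    push_cast
    field_simp
    ring
  rw [lyapunov, step, Real.mul_rpow R_pos.le (by linarith [(abs_le.1 s_le).1])]
  exact mul_le_mul_of_nonneg_left (rpow_neg_third_le s_le) (lyapunov_pos x).le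

theorem sum_lyapunov_le (hd : 3 ≤ d) (x : Fin d → ℤ) :
    ∑ p, lyapunov (x + unitVec p) ≤ 2 * d * lyapunov x := by
  set N : ℝ := ((x ⬝ᵥ x : ℤ) : ℝ) with hN
  have N_nonneg : 0 ≤ N := by rw [hN]; exact_mod_cast dotProduct_self_nonneg x
  have N_eq : N = ∑ i, (x i : ℝ) ^ 2 := by simp [hN, dotProduct, sq]
  let s (p : Fin d × ℤˣ) : ℝ := (1 + 2 * p.2 * x p.1) / (N + 120)
  have pair (i : Fin d) : ∑ ε, (1 - s (i, ε) / 3 + s (i, ε) ^ 2 / 4) =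
      2 - 2 / 3 / (N + 120) + (1 + 4 * (x i : ℝ) ^ 2) / (2 * (N + 120) ^ 2) := by
    rw [UnitsInt.univ, Finset.sum_pair (by decide)]
    simp only [s]
    push_cast
    field_simp
    ring
  have sum_le : ∑ p, (1 - s p / 3 + s p ^ 2 / 4) ≤ (2 * d : ℝ) := by
    have hd' : (3 : ℝ) ≤ d := by exact_mod_cast hd
    rw [Fintype.sum_prod_type]
    simp only [pair, Finset.sum_add_distrib, ← Finset.sum_div, ← Finset.mul_sum, ← N_eq,
      Finset.sum_const, Finset.card_univ, Fintype.card_fin, nsmul_eq_mul]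
    have : (d * 1 + 4 * N) / (2 * (N + 120) ^ 2) ≤ d * (2 / 3 / (N + 120)) := by
      rw [div_le_iff₀ (by positivity)]
      field_simp
      nlinarith
    linarith
  calc ∑ p, lyapunov (x + unitVec p) ≤ ∑ p, lyapunov x * (1 - s p / 3 + s p ^ 2 / 4) :=
        Finset.sum_le_sum fun p _ ↦ lyapunov_add_unitVec_le x p rfl
    _ ≤ 2 * d * lyapunov x := by
        rw [← Finset.mul_sum, mul_comm]
        exact mul_le_mul_of_nonneg_right sum_le (lyapunov_pos x).le

theorem transition_lyapunov_le (hd : 3 ≤ d) :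
    transition (simpleStep d) (fun x ↦ ENNReal.ofReal (lyapunov x)) ≤
      fun x ↦ ENNReal.ofReal (lyapunov x) := fun x ↦ by
  have hd' : (2 * d : ℝ≥0∞) ≠ 0 := by simp; omega
  rw [transition_simpleStep, ← ENNReal.ofReal_sum_of_nonneg fun p _ ↦ (lyapunov_pos _).le,
    ENNReal.inv_mul_le_iff hd' (by finiteness)]
  refine (ENNReal.ofReal_le_ofReal (sum_lyapunov_le hd x)).trans_eq ?_
  simp [ENNReal.ofReal_mul]

theorem lyapunov_unitVec_lt (p : Fin d × ℤˣ) : lyapunov (unitVec p) < lyapunov (0 : Fin d → ℤ) := by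
  have norm_one := dotProduct_self_add_unitVec 0 p
  rw [zero_add] at norm_one
  simp only [lyapunov, norm_one, zero_dotProduct, Pi.zero_apply]
  exact Real.rpow_lt_rpow_of_neg (by norm_num) (by norm_num) (by norm_num)

/-- **Pólya's theorem**. -/
theorem transition_hitting_simpleStep_lt_one (hd : 3 ≤ d) :
    transition (simpleStep d) (hitting (simpleStep d)) 0 < 1 := by
  have : NeZero d := ⟨by omega⟩
  let p : Fin d × ℤˣ := (0, 1)
  rw [← hitting_simpleStep_unitVec p]
  by_contra! h
  have := (mul_le_mul_right h _).trans (mul_hitting_le (transition_lyapunov_le hd) (unitVec p))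
  rw [mul_one] at this
  exact this.not_gt ((ENNReal.ofReal_lt_ofReal_iff (lyapunov_pos _)).2 (lyapunov_unitVec_lt p))

end Lyapunov

section Quadratic

variable {p q r : ℝ}

theorem quadraticRoot_pos (hq : 0 < q) (hr : r = (p + √(p ^ 2 + 4 * q)) / 2) : 0 < r := by
  have : |p| < √(p ^ 2 + 4 * q) := Real.lt_sqrt_of_sq_lt (by rw [sq_abs]; linarith)
  linarith [neg_abs_le p]

theorem quadraticRoot_sq (hq : 0 < q) (hr : r = (p + √(p ^ 2 + 4 * q)) / 2) :
    r ^ 2 = p * r + q := by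
  rw [hr]
  linear_combination Real.sq_sqrt (show 0 ≤ p ^ 2 + 4 * q by positivity) / 4

end Quadratic

section Walk

variable {d : ℕ} {Ω : Type*} [MeasurableSpace Ω] {P : Measure Ω} [IsProbabilityMeasure P]
  {X : ℕ → Ω → (Fin d → ℤ)}

theorem IsRandomWalk.map_eq_simpleStep [NeZero d] (hX : IsRandomWalk X P) (h : IsSimple X P) :
    P.map (X 1) = simpleStep d := by
  classical
  have := hX.isProbabilityMeasure_map
  have atom (p : Fin d × ℤˣ) : P.map (X 1) {unitVec p} = (2 * d : ℝ≥0∞)⁻¹ := by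
    have hd : (0 : ℝ) < d := by simp [NeZero.pos d]
    have real_atom : P.real (X 1 ⁻¹' {unitVec p}) = 1 / (2 * (d : ℝ)) :=
      h _ (unitVec_mem_unitSphere p)
    rw [Measure.map_apply (hX.measurable 1) .of_discrete, ← ofReal_measureReal, real_atom,
      one_div, ENNReal.ofReal_inv_of_pos (by positivity)]
    simp [ENNReal.ofReal_mul]
  refine (Measure.eq_of_le_of_isProbabilityMeasure (Measure.le_iff.2 fun s _ ↦ ?_)).symm
  calc simpleStep d s = ∑ a ∈ unitVectors d with a ∈ s, P.map (X 1) {a} := by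
        simp [simpleStep, Measure.finsetSum_apply, Set.indicator_apply, unitVectors,
          Finset.filter_map, atom, mul_comm]
    _ = P.map (X 1) ({a ∈ unitVectors d | a ∈ s} : Finset _) := sum_measure_singleton
    _ ≤ P.map (X 1) s := measure_mono fun a ha ↦ (Finset.mem_filter.1 ha).2

theorem IsRandomWalk.isTransient_of_isSimple (hX : IsRandomWalk X P) (h : IsSimple X P)
    (hd : 3 ≤ d) : IsTransient X P := by
  have : NeZero d := ⟨by omega⟩
  rw [IsTransient, hX.noReturnProb_eq, hX.map_eq_simpleStep h, sub_pos]
  exact ENNReal.toReal_lt_of_lt_ofReal (by simpa using transition_hitting_simpleStep_lt_one hd)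

variable [NeZero d]

theorem IsRandomWalk.one_le_mul_one_sub_noReturnProb (hX : IsRandomWalk X P)
    (h : IsSimple X P) : 1 ≤ 2 * d * (1 - noReturnProb X P) := by
  have hd : (0 : ℝ) < 2 * d := by simp [NeZero.pos d]
  rw [hX.noReturnProb_eq, hX.map_eq_simpleStep h, sub_sub_cancel, ← inv_le_iff_one_le_mul₀' hd]
  simpa using ENNReal.toReal_mono
    (ne_top_of_le_ne_top ENNReal.one_ne_top (transition_hitting_le_one 0))
    (inv_two_mul_le_transition_hitting (d := d))

theorem IsRandomWalk.noReturnProb_lt_one_of_isSimple (hX : IsRandomWalk X P)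
    (h : IsSimple X P) : noReturnProb X P < 1 :=
  hX.noReturnProb_lt_one (by rw [hX.map_eq_simpleStep h, simpleStep_map_neg])

theorem IsRandomWalk.sum_unitVectors_hitting (hX : IsRandomWalk X P) (h : IsSimple X P)
    {x : Fin d → ℤ} (hx : x ∈ unitBall d) :
    ∑ a ∈ unitVectors d, (hitting (P.map (X 1)) (x - a)).toReal =
      2 * d * (1 - noReturnProb X P) := by
  rw [hX.noReturnProb_eq, hX.map_eq_simpleStep h, sub_sub_cancel,
    LatticeWalk.sum_unitVectors_hitting hx]

theorem IsRandomWalk.sum_insert_unitVectors_hitting (hX : IsRandomWalk X P) (h : IsSimple X P)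
    (r : ℝ) {x : Fin d → ℤ} (hx : x ∈ unitBall d) :
    ∑ a ∈ insert 0 (unitVectors d),
        (if a = 0 then 1 else r) * (hitting (P.map (X 1)) (x - a)).toReal =
      (hitting (P.map (X 1)) x).toReal + r * (2 * d * (1 - noReturnProb X P)) := by
  rw [Finset.sum_insert zero_notMem_unitVectors, if_pos rfl, one_mul, sub_zero,
    ← hX.sum_unitVectors_hitting h hx, Finset.mul_sum]
  exact congrArg _ (Finset.sum_congr rfl fun a ha ↦ by
    rw [if_neg (ne_of_mem_of_not_mem ha zero_notMem_unitVectors)])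

theorem IsRandomWalk.hitting_unitVec (hX : IsRandomWalk X P) (h : IsSimple X P)
    (p : Fin d × ℤˣ) :
    (hitting (P.map (X 1)) (unitVec p)).toReal = 1 - noReturnProb X P := by
  rw [hX.noReturnProb_eq, hX.map_eq_simpleStep h, sub_sub_cancel, hitting_simpleStep_unitVec]

theorem IsRandomWalk.tendsto_maxOccupationRatio_unitSphere (hX : IsRandomWalk X P)
    (h : IsSimple X P) (htrans : IsTransient X P) :
    ∀ᵐ ω ∂P, Tendsto (maxOccupationRatio (fun n ↦ X n ω) (unitSphere d)) atTop
      (𝓝 (-1 / Real.log (1 - noReturnProb X P / (2 * d * (1 - noReturnProb X P))))) := by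
  have γ_lt : noReturnProb X P < 2 * d * (1 - noReturnProb X P) :=
    (hX.noReturnProb_lt_one_of_isSimple h).trans_le (hX.one_le_mul_one_sub_noReturnProb h)
  rw [← coe_unitVectors]
  refine hX.tendsto_maxOccupationRatio_of_eigenvector htrans
    ⟨unitVec (0, 1), mem_unitVectors.2 ⟨_, rfl⟩⟩ (w := 1) (fun _ _ ↦ one_pos) γ_lt fun x hx ↦ ?_
  simp only [Pi.one_apply, one_mul, mul_one]
  refine hX.sum_unitVectors_hitting h (Set.mem_insert_of_mem 0 ?_)
  rwa [← coe_unitVectors]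

/-- The eigenvector is `1` at the origin and `r` on the sphere. -/
theorem IsRandomWalk.tendsto_maxOccupationRatio_unitBall (hX : IsRandomWalk X P)
    (h : IsSimple X P) (htrans : IsTransient X P) {p r : ℝ}
    (hp : p = 1 - 1 / (2 * d * (1 - noReturnProb X P)))
    (hr : r = (p + √(p ^ 2 + 2 / d)) / 2) :
    ∀ᵐ ω ∂P, Tendsto (maxOccupationRatio (fun n ↦ X n ω) (unitBall d)) atTop
      (𝓝 (-1 / Real.log r)) := by
  set γ := noReturnProb X P
  have hd : (0 : ℝ) < 2 * d := by simp [NeZero.pos d]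
  have u_pos : 0 < 1 - γ := sub_pos.2 (hX.noReturnProb_lt_one_of_isSimple h)
  rw [show (2 / d : ℝ) = 4 * (1 / (2 * d)) by field_simp; norm_num] at hr
  have r_pos : 0 < r := quadraticRoot_pos (by positivity) hr
  have r_sq : 2 * d * (1 - γ) * r ^ 2 = 2 * d * (1 - γ) * r - r + (1 - γ) := by
    have hd0 : (d : ℝ) ≠ 0 := by simp [NeZero.ne d]
    rw [quadraticRoot_sq (by positivity) hr, hp]
    field_simp
  set Λ := 1 + 2 * d * (1 - γ) * r with hΛ
  have Λ_gt : 1 < Λ := lt_add_of_pos_right 1 (by positivity)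
  have rate : 1 - γ / Λ = r := by
    rw [sub_eq_iff_eq_add, ← sub_eq_iff_eq_add', eq_div_iff (by positivity), hΛ]
    linear_combination -r_sq
  rw [← rate, ← coe_insert_unitVectors]
  refine hX.tendsto_maxOccupationRatio_of_eigenvector htrans (Finset.insert_nonempty ..)
    (w := fun x ↦ if x = 0 then 1 else r) (fun x _ ↦ by split_ifs <;> positivity)
    ((sub_pos.1 u_pos).trans Λ_gt) fun x hx ↦ ?_
  rw [hX.sum_insert_unitVectors_hitting h r (coe_insert_unitVectors ▸ hx)]
  obtain rfl | hx := Finset.mem_insert.1 hx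
  · rw [hitting_zero, if_pos rfl, ENNReal.toReal_one]
    ring
  · obtain ⟨p, rfl⟩ := mem_unitVectors.1 hx
    rw [hX.hitting_unitVec h, if_neg (unitVec_ne_zero p)]
    linear_combination -r_sq

end Walk

end LatticeWalk

theorem theorem1p2_general {d : ℕ} {Ω : Type*} [MeasurableSpace Ω] (P : Measure Ω)
    [IsProbabilityMeasure P] (X : ℕ → Ω → (Fin d → ℤ)) (hX : IsRandomWalk X P) :
    (IsSymmetric X P → IsTransient X P → ∀ y : Fin d → ℤ, y ≠ 0 →
      ∀ᵐ ω ∂P, Tendsto (maxOccupationRatio (fun n => X n ω) {0, y}) atTop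
        (𝓝 (-1 / Real.log (1 - noReturnProb X P / (1 + hitProb X P y))))) ∧
    (3 ≤ d → IsSimple X P →
      (∀ᵐ ω ∂P, Tendsto (maxOccupationRatio (fun n => X n ω) (unitSphere d)) atTop
        (𝓝 (-1 / Real.log
          (1 - noReturnProb X P / (2 * (d : ℝ) * (1 - noReturnProb X P)))))) ∧
      (∀ p : ℝ, p = 1 - 1 / (2 * (d : ℝ) * (1 - noReturnProb X P)) →
        ∀ᵐ ω ∂P, Tendsto (maxOccupationRatio (fun n => X n ω) (unitBall d)) atTop
          (𝓝 (-1 / Real.log ((p + Real.sqrt (p ^ 2 + 2 / (d : ℝ))) / 2))))) := by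
  refine ⟨fun hsymm htrans y hy ↦ hX.tendsto_maxOccupationRatio_pair hsymm htrans hy,
    fun hd h ↦ ?_⟩
  have : NeZero d := ⟨by omega⟩
  have htrans := hX.isTransient_of_isSimple h hd
  exact ⟨hX.tendsto_maxOccupationRatio_unitSphere h htrans,
    fun p hp ↦ hX.tendsto_maxOccupationRatio_unitBall h htrans hp rfl⟩

theorem theorem1p2 {d : ℕ} (hd : 3 ≤ d) {Ω : Type*} [MeasurableSpace Ω] (P : Measure Ω)
    [IsProbabilityMeasure P] (X : ℕ → Ω → (Fin d → ℤ)) (hX : IsRandomWalk X P) :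
    (IsSymmetric X P → IsTransient X P → IsFull X P → HasSecondMoments X P →
      ∀ y : Fin d → ℤ, y ≠ 0 →
        ∀ᵐ ω ∂P, Tendsto (maxOccupationRatio (fun n => X n ω) {0, y}) atTop
          (𝓝 (-1 / Real.log (1 - noReturnProb X P / (1 + hitProb X P y))))) ∧
    (IsSimple X P →
      (∀ᵐ ω ∂P, Tendsto (maxOccupationRatio (fun n => X n ω) (unitSphere d)) atTop
        (𝓝 (-1 / Real.log
          (1 - noReturnProb X P / (2 * (d : ℝ) * (1 - noReturnProb X P)))))) ∧
      (∀ p : ℝ, p = 1 - 1 / (2 * (d : ℝ) * (1 - noReturnProb X P)) →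
        ∀ᵐ ω ∂P, Tendsto (maxOccupationRatio (fun n => X n ω) (unitBall d)) atTop
          (𝓝 (-1 / Real.log ((p + Real.sqrt (p ^ 2 + 2 / (d : ℝ))) / 2))))) :=
  ⟨fun hsymm htrans _ _ ↦ (theorem1p2_general P X hX).1 hsymm htrans,
    (theorem1p2_general P X hX).2 hd⟩
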